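/- For $n\ge 1$ let $\mu_n$ be the normalized Haar measure of $Spin(2n+1)$, let $e,e'$ be the last two vectors of the standard orthonormal basis of $\mathbb R^{2n+1}$, and let $Spin(2n-1)\subset Spin(2n+1)$ be the subgroup coming from $\mathbb R^{2n-1}=\{e,e'\}^\perp$. Write $g\cdot v$ for the action of $g\in Spin(2n+1)$ on $v\in\mathbb R^{2n+1}$ by rotations, and let $S^{2n}\subset\mathbb R^{2n+1}$ and $S^{2n-1}\subset\mathbb R^{2n}=e^\perp$ be the unit spheres. Let $s_n:S^{2n}\to Spin(2n+1)$ be any Borel section, i.e. a Borel map such that $s_n(x)\cdot e=x$ for all $x$. (Such maps exist, and there are some which are continuous off one point.) View $Spin(2n+1)$ as fibred over $B_n=S^{2n}\times S^{2n-1}$ by $$\pi_n:Spin(2n+1)\to B_n,\qquad \pi_n(g)=(x,y),\quad x=g\cdot e,\quad y=s_n(x)^{-1}g\cdot e'.$$ Let $p_n\in S^{2n}$ and $q_n\in S^{2n-1}$ be arbitrary, let $S_n=\{(x,y)\in B_n:\langle p_n,x\rangle=0,\ \langle q_n,y\rangle=0\}$ be the bi-equator (the product of the equators of the two spheres with poles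 $p_n$ and $q_n$), and let $\Sigma_n=\pi_n^{-1}(S_n)$. Then: 1. For every $n$, $\pi_n$ induces a bijection $Spin(2n+1)/Spin(2n-1)\to S^{2n}\times S^{2n-1}$, and over every open set $U\subset S^{2n}$ on which $s_n$ is continuous this bijection restricts to a homeomorphism from the classes of the $g$ with $g\cdot e\in U$ onto $U\times S^{2n-1}$. 2. $S_n$, with the distance of $B_n$, is isometric to $S^{2n-1}\times S^{2n-2}$; so it has codimension two in $B_n$. (The spheres carry the Euclidean distance of the ambient space, and the products carry the maximum of the distances of the two components.) 3. The measures $\mu_n$ concentrate on $\Sigma_n$ as $n\to\infty$: for every $\varepsilon>0$, $$\mu_n\bigl(\pi_n^{-1}(N_\varepsilon(S_n))\bigr)\to 1\qquad\text{and}\qquad \mu_n\bigl(N_\varepsilon(\Sigma_n)\bigr)\to 1 .$$ Here $N_\varepsilon(S_n)$ is the open $\varepsilon$-neighbourhood of $S_n$ in $B_n$, and $N_\varepsilon(\Sigma_n)$ is the open $\varepsilon$-neighbourhood of $\Sigma_n$ for the Riemannian distance on $Spin(2n+1)$ of the bi-invariant metric $-\frac12\mathrm{Tr}(R^{-1}dR\otimes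 R^{-1}dR)$, where $R\in SO(2n+1)$ is the rotation defined by $g$. -/

import Mathlib

open Metric Set Filter Topology MeasureTheory
open scoped Pointwise ENNReal RealInnerProductSpace

namespace SpinBundle

noncomputable section

/-- Euclidean space `ℝ^m`. -/
abbrev Euc (m : ℕ) : Type := EuclideanSpace ℝ (Fin m)

/-- The quadratic form `v ↦ ‖v‖²` on `ℝ^m`. -/
def normSq (m : ℕ) : QuadraticForm ℝ (Euc m) :=
  LinearMap.BilinMap.toQuadraticMap (innerₗ (Euc m))

theorem normSq_apply {m : ℕ} (v : Euc m) : normSq m v = ⟪v, v⟫ := by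
  simp [normSq]

/-- The Clifford algebra of `ℝ^m`, with `v * v = ‖v‖²`. -/
abbrev Cl (m : ℕ) : Type := CliffordAlgebra (normSq m)

/-- The inclusion of the vectors in the Clifford algebra. -/
abbrev vec {m : ℕ} : Euc m →ₗ[ℝ] Cl m := CliffordAlgebra.ι (normSq m)

theorem vec_mul_self {m : ℕ} (v : Euc m) : vec v * vec v = ⟪v, v⟫ • (1 : Cl m) := by
  rw [CliffordAlgebra.ι_sq_scalar, normSq_apply, Algebra.algebraMap_eq_smul_one]

theorem vec_mul_self_of_unit {m : ℕ} {v : Euc m} (hv : ‖v‖ = 1) : vec v * vec v = 1 := by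
  rw [vec_mul_self, real_inner_self_eq_norm_sq, hv]; simp

theorem vec_mul_swap {m : ℕ} (v w : Euc m) :
    vec v * vec w = (2 * ⟪v, w⟫) • (1 : Cl m) - vec w * vec v := by
  have h := CliffordAlgebra.ι_mul_ι_add_swap (Q := normSq m) v w
  rw [eq_sub_iff_add_eq, h, Algebra.algebraMap_eq_smul_one]
  congr 1
  rw [normSq, LinearMap.BilinMap.polar_toQuadraticMap]
  simp only [innerₗ_apply_apply, real_inner_comm v w]
  ring

/-- Up to sign, the unit vectors of a subspace `W`, inside the Clifford algebra. -/
def unitVecs {m : ℕ} (W : Submodule ℝ (Euc m)) : Set (Cl m) :=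
  vec '' {v | v ∈ W ∧ ‖v‖ = 1} ∪ {1, -1}

/-- The products of unit vectors of `W` and of signs. -/
def unitProds {m : ℕ} (W : Submodule ℝ (Euc m)) : Submonoid (Cl m) :=
  Submonoid.closure (unitVecs W)

theorem neg_mem_unitVecs {m : ℕ} {W : Submodule ℝ (Euc m)} {x : Cl m} (hx : x ∈ unitVecs W) :
    -x ∈ unitVecs W := by
  rcases hx with ⟨v, ⟨h1, h2⟩, rfl⟩ | rfl | rfl
  · exact Or.inl ⟨-v, ⟨W.neg_mem h1, by simpa using h2⟩, by simp⟩
  · exact Or.inr (by simp)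
  · exact Or.inr (by simp)

theorem unitVecs_mono {m : ℕ} {W W' : Submodule ℝ (Euc m)} (h : W ≤ W') :
    unitVecs W ⊆ unitVecs W' :=
  union_subset_union_left _ (image_mono fun _ hv => ⟨h hv.1, hv.2⟩)

theorem vec_mul_vec_exchange {m : ℕ} {W : Submodule ℝ (Euc m)} {e v w : Euc m}
    (hv : v ∈ W) (hw : w ∈ W) (hv1 : ‖v‖ = 1) (hw1 : ‖w‖ = 1) :
    ∃ a ∈ unitVecs (W ⊓ (ℝ ∙ e)ᗮ), ∃ b ∈ unitVecs W, vec v * vec w = a * b := by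
  have hperp : ∀ u : Euc m, u ∈ W → ⟪e, u⟫ = 0 → u ∈ W ⊓ (ℝ ∙ e)ᗮ := fun u hu h =>
    ⟨hu, Submodule.mem_orthogonal_singleton_iff_inner_right.2 h⟩
  have hpar : ∀ t : ℝ, v = t • w →
      ∃ a ∈ unitVecs (W ⊓ (ℝ ∙ e)ᗮ), ∃ b ∈ unitVecs W, vec v * vec w = a * b := by
    intro t ht
    have hh : vec v * vec w = t • (1 : Cl m) := by
      rw [ht, map_smul, smul_mul_assoc, vec_mul_self_of_unit hw1]
    have : |t| = 1 := by
      have := congrArg norm ht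
      rw [norm_smul, hv1, hw1] at this
      simpa using this.symm
    rcases (abs_eq zero_le_one).1 this with h | h
    · exact ⟨1, Or.inr (by simp), 1, Or.inr (by simp), by rw [hh, h]; simp⟩
    · exact ⟨1, Or.inr (by simp), -1, Or.inr (by simp), by rw [hh, h]; simp⟩
  by_cases h0 : ⟪e, v⟫ = 0 ∧ ⟪e, w⟫ = 0
  · exact ⟨vec v, Or.inl ⟨v, ⟨hperp v hv h0.1, hv1⟩, rfl⟩, vec w, Or.inl ⟨w, ⟨hw, hw1⟩, rfl⟩, rfl⟩
  by_cases hc : ⟪e, w⟫ • v - ⟪e, v⟫ • w = 0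
  · by_cases hew : ⟪e, w⟫ = 0
    · have hev : ⟪e, v⟫ ≠ 0 := fun h => h0 ⟨h, hew⟩
      rw [hew, zero_smul, zero_sub, neg_eq_zero, smul_eq_zero] at hc
      rcases hc with hc | hc
      · exact absurd hc hev
      · rw [hc] at hw1; simp at hw1
    · refine hpar (⟪e, w⟫⁻¹ * ⟪e, v⟫) ?_
      rw [mul_smul, ← sub_eq_zero.1 hc, smul_smul, inv_mul_cancel₀ hew, one_smul]
  · set c := ⟪e, w⟫ • v - ⟪e, v⟫ • w with hcdef
    have hcn : ‖c‖ ≠ 0 := norm_ne_zero_iff.2 hc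
    obtain ⟨α, β, hαβ⟩ : ∃ α β : ℝ, ‖c‖⁻¹ • c = α • v + β • w :=
      ⟨‖c‖⁻¹ * ⟪e, w⟫, -(‖c‖⁻¹ * ⟪e, v⟫), by rw [hcdef]; module⟩
    have hunit : ‖‖c‖⁻¹ • c‖ = 1 := by
      rw [norm_smul, norm_inv, norm_norm, inv_mul_cancel₀ hcn]
    have hvv : ⟪v, v⟫ = 1 := by rw [real_inner_self_eq_norm_sq, hv1]; norm_num
    have hww : ⟪w, w⟫ = 1 := by rw [real_inner_self_eq_norm_sq, hw1]; norm_num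
    have hsq : α ^ 2 + β ^ 2 + 2 * α * β * ⟪v, w⟫ = 1 := by
      have := real_inner_self_eq_norm_sq (‖c‖⁻¹ • c)
      rw [hunit, hαβ] at this
      simp only [inner_add_left, inner_add_right, real_inner_smul_left, real_inner_smul_right,
        hvv, hww, real_inner_comm v w] at this
      linarith
    set b := (α + 2 * β * ⟪v, w⟫) • w - β • v with hb
    have hbn : ‖b‖ = 1 := by
      have := real_inner_self_eq_norm_sq b
      rw [hb] at this
      simp only [inner_sub_left, inner_sub_right, real_inner_smul_left, real_inner_smul_right,
        hvv, hww, real_inner_comm v w] at this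
      rw [← hb] at this
      have h2 : ‖b‖ ^ 2 = 1 := by linear_combination hsq - this
      exact (pow_eq_one_iff_of_nonneg (norm_nonneg _) two_ne_zero).1 h2
    refine ⟨vec (‖c‖⁻¹ • c), Or.inl ⟨_, ⟨hperp _ ?_ ?_, hunit⟩, rfl⟩, vec b,
      Or.inl ⟨b, ⟨?_, hbn⟩, rfl⟩, ?_⟩
    · exact W.smul_mem _ (W.sub_mem (W.smul_mem _ hv) (W.smul_mem _ hw))
    · rw [real_inner_smul_right, hcdef, inner_sub_right, real_inner_smul_right,
        real_inner_smul_right]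
      ring
    · exact W.sub_mem (W.smul_mem _ hw) (W.smul_mem _ hv)
    · rw [hαβ, hb]
      simp only [map_add, map_sub, map_smul, add_mul, mul_sub, smul_mul_smul_comm,
        vec_mul_self_of_unit hv1, vec_mul_self_of_unit hw1, vec_mul_swap w v,
        real_inner_comm v w]
      have : vec v * vec w = (1 : ℝ) • (vec v * vec w) := by simp
      conv_lhs => rw [this, ← hsq]
      module

theorem one_mem_unitVecs {m : ℕ} (W : Submodule ℝ (Euc m)) : (1 : Cl m) ∈ unitVecs W :=
  Or.inr (by simp)

theorem unitProds_subset_mul {m : ℕ} {W : Submodule ℝ (Euc m)} (e : Euc m) :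
    (unitProds W : Set (Cl m)) ⊆ unitVecs W * (unitProds (W ⊓ (ℝ ∙ e)ᗮ) : Set (Cl m)) := by
  intro x hx
  have hneg : ∀ y ∈ unitVecs W * (unitProds (W ⊓ (ℝ ∙ e)ᗮ) : Set (Cl m)),
      -y ∈ unitVecs W * (unitProds (W ⊓ (ℝ ∙ e)ᗮ) : Set (Cl m)) := by
    rintro _ ⟨u, hu, g, hg, rfl⟩
    exact ⟨-u, neg_mem_unitVecs hu, g, hg, by simp⟩
  -- reversed order of the exchange
  have hex : ∀ v w : Euc m, v ∈ W → w ∈ W → ‖v‖ = 1 → ‖w‖ = 1 →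
      ∃ b ∈ unitVecs W, ∃ a ∈ unitVecs (W ⊓ (ℝ ∙ e)ᗮ), vec v * vec w = b * a := by
    intro v w hv hw hv1 hw1
    obtain ⟨a, ha, b, hb, h⟩ := vec_mul_vec_exchange (e := e) hw hv hw1 hv1
    have hrev : ∀ (W : Submodule ℝ (Euc m)) (z : Cl m), z ∈ unitVecs W →
        CliffordAlgebra.reverse z = z := by
      rintro W z (⟨v, -, rfl⟩ | rfl | rfl)
      · simp
      · simp
      · rw [map_neg, CliffordAlgebra.reverse.map_one]
    refine ⟨b, hb, a, ha, ?_⟩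
    have := congrArg CliffordAlgebra.reverse h
    rwa [CliffordAlgebra.reverse.map_mul, CliffordAlgebra.reverse.map_mul, hrev _ _ ha,
      hrev _ _ hb, CliffordAlgebra.reverse_ι, CliffordAlgebra.reverse_ι] at this
  induction hx using Submonoid.closure_induction_left with
  | one => exact ⟨1, one_mem_unitVecs W, 1, one_mem _, by simp⟩
  | mul_left y hy z hz ih =>
    obtain ⟨u, hu, g, hg, rfl⟩ := ih
    rcases hy with ⟨v, ⟨hv, hv1⟩, rfl⟩ | rfl | rfl
    · rcases hu with ⟨w, ⟨hw, hw1⟩, rfl⟩ | rfl | rfl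
      · obtain ⟨b, hb, a, ha, h⟩ := hex v w hv hw hv1 hw1
        exact ⟨b, hb, a * g, mul_mem (Submonoid.subset_closure ha) hg, by
          simp only [← mul_assoc, h]⟩
      · exact ⟨vec v, Or.inl ⟨v, ⟨hv, hv1⟩, rfl⟩, g, hg, by simp⟩
      · exact ⟨-vec v, neg_mem_unitVecs (Or.inl ⟨v, ⟨hv, hv1⟩, rfl⟩), g, hg, by simp⟩
    · exact ⟨u, hu, g, hg, by simp⟩
    · exact ⟨-u, neg_mem_unitVecs hu, g, hg, by simp⟩

theorem unitProds_subset_pow {m : ℕ} (k : ℕ) : ∀ W : Submodule ℝ (Euc m),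
    Module.finrank ℝ W ≤ k → (unitProds W : Set (Cl m)) ⊆ unitVecs W ^ (k + 1) := by
  induction k with
  | zero =>
    intro W hW x hx
    rw [zero_add, pow_one]
    have hbot : W = ⊥ := Submodule.finrank_eq_zero.1 (Nat.le_zero.1 hW)
    induction hx using Submonoid.closure_induction_left with
    | one => exact one_mem_unitVecs W
    | mul_left y hy z hz ih =>
      rcases hy with ⟨v, ⟨hv, hv1⟩, rfl⟩ | rfl | rfl
      · rw [hbot, Submodule.mem_bot] at hv
        rw [hv] at hv1
        simp at hv1
      · simpa using ih
      · simpa using neg_mem_unitVecs ih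
  | succ k ih =>
    intro W hW
    by_cases hbot : W = ⊥
    · exact (ih W (by rw [hbot]; simp)).trans
        (Set.pow_subset_pow_right (one_mem_unitVecs W) (Nat.le_succ _))
    obtain ⟨e, he, he0⟩ := Submodule.exists_mem_ne_zero_of_ne_bot hbot
    have hlt : W ⊓ (ℝ ∙ e)ᗮ < W := by
      refine lt_of_le_of_ne inf_le_left fun h => he0 ?_
      have : e ∈ (ℝ ∙ e)ᗮ := (h.symm ▸ he : e ∈ W ⊓ (ℝ ∙ e)ᗮ).2
      rw [Submodule.mem_orthogonal_singleton_iff_inner_right] at this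
      exact inner_self_eq_zero.1 this
    have hfr := Submodule.finrank_lt_finrank_of_lt hlt
    refine (unitProds_subset_mul e).trans ?_
    rw [pow_succ' (unitVecs W) (k + 1)]
    exact Set.mul_subset_mul_left ((ih _ (by omega)).trans
      (Set.pow_subset_pow_left (unitVecs_mono inf_le_left)))

theorem vec_mem_span_unitProds {m : ℕ} (v : Euc m) :
    vec v ∈ Submodule.span ℝ (unitProds (⊤ : Submodule ℝ (Euc m)) : Set (Cl m)) := by
  by_cases hv : v = 0
  · rw [hv, map_zero]; exact zero_mem _
  have hn : ‖v‖ ≠ 0 := norm_ne_zero_iff.2 hv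
  have : vec v = ‖v‖ • vec (‖v‖⁻¹ • v) := by
    rw [← map_smul, smul_smul, mul_inv_cancel₀ hn, one_smul]
  rw [this]
  refine Submodule.smul_mem _ _ (Submodule.subset_span (Submonoid.subset_closure
    (Or.inl ⟨_, ⟨trivial, ?_⟩, rfl⟩)))
  rw [norm_smul, norm_inv, norm_norm, inv_mul_cancel₀ hn]

theorem span_unitProds (m : ℕ) :
    Submodule.span ℝ (unitProds (⊤ : Submodule ℝ (Euc m)) : Set (Cl m)) = ⊤ := by
  refine eq_top_iff.2 fun x _ => ?_
  induction x using CliffordAlgebra.induction with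
  | algebraMap r =>
    rw [Algebra.algebraMap_eq_smul_one]
    exact Submodule.smul_mem _ _ (Submodule.subset_span (one_mem _))
  | ι v => exact vec_mem_span_unitProds v
  | mul a b ha hb =>
    have := Submodule.mul_mem_mul (ha trivial) (hb trivial)
    rw [Submodule.span_mul_span] at this
    refine Submodule.span_mono ?_ this
    rintro _ ⟨u, hu, w, hw, rfl⟩
    exact mul_mem hu hw
  | add a b ha hb => exact add_mem (ha trivial) (hb trivial)

instance instFiniteCl (m : ℕ) : Module.Finite ℝ (Cl m) := by
  let V : Submodule ℝ (Cl m) := Submodule.span ℝ {1} ⊔ LinearMap.range (vec (m := m))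
  have hV : V.FG := (Submodule.fg_span_singleton _).sup (by
    rw [LinearMap.range_eq_map]; exact Module.Finite.fg_top.map _)
  have hU : unitVecs (⊤ : Submodule ℝ (Euc m)) ⊆ V := by
    have h1 : (1 : Cl m) ∈ V := Submodule.mem_sup_left (Submodule.mem_span_singleton_self _)
    rintro _ (⟨v, -, rfl⟩ | rfl | rfl)
    · exact Submodule.mem_sup_right ⟨v, rfl⟩
    · exact h1
    · exact V.neg_mem h1
  refine ⟨?_⟩
  have : (⊤ : Submodule ℝ (Cl m)) = V ^ (m + 1) := by
    refine (eq_top_iff.2 ?_).symm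
    rw [← span_unitProds m]
    refine Submodule.span_le.2 ((unitProds_subset_pow m ⊤ (by simp)).trans ?_)
    exact (Set.pow_subset_pow_left hU).trans (Submodule.pow_subset_pow V)
  rw [this]
  exact hV.pow _

/-- The topology of a finite-dimensional real vector space. -/
instance instTopologicalSpaceCl (m : ℕ) : TopologicalSpace (Cl m) := moduleTopology ℝ (Cl m)

instance instIsModuleTopologyCl (m : ℕ) : IsModuleTopology ℝ (Cl m) := ⟨rfl⟩

instance instIsTopologicalRingCl (m : ℕ) : IsTopologicalRing (Cl m) :=
  IsModuleTopology.isTopologicalRing ℝ (Cl m)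

instance instT2SpaceCl (m : ℕ) : T2Space (Cl m) :=
  T2Space.of_injective_continuous (Module.finBasis ℝ (Cl m)).equivFun.injective
    (IsModuleTopology.continuous_of_linearMap
      (Module.finBasis ℝ (Cl m)).equivFun.toLinearMap)

/-- The spin group of `ℝ^m`, with the topology of the Clifford algebra. -/
abbrev Spin (m : ℕ) : Type := spinGroup (normSq m)

theorem isCompact_unitVecs (m : ℕ) : IsCompact (unitVecs (⊤ : Submodule ℝ (Euc m))) := by
  refine IsCompact.union ?_ ((finite_singleton _).insert _).isCompact
  have : {v : Euc m | v ∈ (⊤ : Submodule ℝ (Euc m)) ∧ ‖v‖ = 1} = sphere 0 1 := by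
    ext v; simp
  rw [this]
  exact (isCompact_sphere _ _).image (LinearMap.continuous_of_finiteDimensional _)

theorem isCompact_unitProds (m : ℕ) :
    IsCompact (unitProds (⊤ : Submodule ℝ (Euc m)) : Set (Cl m)) := by
  have : (unitProds (⊤ : Submodule ℝ (Euc m)) : Set (Cl m)) =
      unitVecs (⊤ : Submodule ℝ (Euc m)) ^ (m + 1) := by
    refine (unitProds_subset_pow m ⊤ (by simp)).antisymm ?_
    have hpow : ∀ k : ℕ, unitVecs (⊤ : Submodule ℝ (Euc m)) ^ k ⊆
        (unitProds (⊤ : Submodule ℝ (Euc m)) : Set (Cl m)) := by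
      intro k
      induction k with
      | zero => simp [one_mem]
      | succ k ih =>
        rw [pow_succ]
        rintro _ ⟨a, ha, b, hb, rfl⟩
        exact mul_mem (ih ha) (Submonoid.subset_closure hb)
    exact hpow _
  rw [this]
  have hpow : ∀ k : ℕ, IsCompact (unitVecs (⊤ : Submodule ℝ (Euc m)) ^ k) := by
    intro k
    induction k with
    | zero => rw [pow_zero]; exact isCompact_singleton
    | succ k ih => rw [pow_succ]; exact ih.mul (isCompact_unitVecs m)
  exact hpow _

theorem exists_smul_of_mem_lipschitz {m : ℕ} {x : (Cl m)ˣ} (hx : x ∈ lipschitzGroup (normSq m)) :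
    ∃ c : ℝ, 0 < c ∧ ∃ y ∈ unitProds (⊤ : Submodule ℝ (Euc m)), (x : Cl m) = c • y := by
  have key : ∀ v : Euc m, v ≠ 0 → ∃ y ∈ unitProds (⊤ : Submodule ℝ (Euc m)),
      vec v = ‖v‖ • y := by
    intro v hv
    have hn : ‖v‖ ≠ 0 := norm_ne_zero_iff.2 hv
    refine ⟨vec (‖v‖⁻¹ • v), Submonoid.subset_closure (Or.inl ⟨_, ⟨trivial, ?_⟩, rfl⟩), ?_⟩
    · rw [norm_smul, norm_inv, norm_norm, inv_mul_cancel₀ hn]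
    · rw [← map_smul, smul_smul, mul_inv_cancel₀ hn, one_smul]
  have hne : ∀ (x : (Cl m)ˣ) (v : Euc m), vec v = (x : Cl m) → v ≠ 0 := by
    rintro x v hv rfl
    rw [map_zero] at hv
    exact x.ne_zero hv.symm
  induction hx using Subgroup.closure_induction'' with
  | mem x hx =>
    obtain ⟨v, hv⟩ := hx
    obtain ⟨y, hy, h⟩ := key v (hne x v hv)
    exact ⟨‖v‖, norm_pos_iff.2 (hne x v hv), y, hy, by rw [← hv, h]⟩
  | inv_mem x hx =>
    obtain ⟨v, hv⟩ := hx
    have hv0 := hne x v hv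
    have hn : ‖v‖ ≠ 0 := norm_ne_zero_iff.2 hv0
    obtain ⟨y, hy, h⟩ := key v hv0
    refine ⟨‖v‖⁻¹, inv_pos.2 (norm_pos_iff.2 hv0), y, hy, ?_⟩
    refine Units.inv_eq_of_mul_eq_one_right ?_
    have hy2 : vec v * vec v = (‖v‖ ^ 2) • (1 : Cl m) := by
      rw [vec_mul_self, real_inner_self_eq_norm_sq]
    have : y = ‖v‖⁻¹ • vec v := by rw [h, smul_smul, inv_mul_cancel₀ hn, one_smul]
    rw [← hv, this, mul_smul_comm, mul_smul_comm, hy2, smul_smul, smul_smul]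
    field_simp
    simp
  | one => exact ⟨1, one_pos, 1, one_mem _, by simp⟩
  | mul x y _ _ hx hy =>
    obtain ⟨c, hc, u, hu, h⟩ := hx
    obtain ⟨d, hd, w, hw, h'⟩ := hy
    exact ⟨c * d, mul_pos hc hd, u * w, mul_mem hu hw, by
      rw [Units.val_mul, h, h', smul_mul_smul_comm]⟩

theorem unitProds_parity {m : ℕ} {y : Cl m} (hy : y ∈ unitProds (⊤ : Submodule ℝ (Euc m))) :
    (star y * y = 1 ∧ y * star y = 1 ∧ y ∈ CliffordAlgebra.evenOdd (normSq m) 0) ∨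
      (star y * y = -1 ∧ y * star y = -1 ∧ y ∈ CliffordAlgebra.evenOdd (normSq m) 1) := by
  induction hy using Submonoid.closure_induction_left with
  | one => exact Or.inl ⟨by simp, by simp, SetLike.one_mem_graded (CliffordAlgebra.evenOdd (normSq m))⟩
  | mul_left x hx z hz ih =>
    rcases hx with ⟨v, ⟨-, hv1⟩, rfl⟩ | rfl | rfl
    · have hvv := vec_mul_self_of_unit hv1
      have h1 : star (vec v * z) * (vec v * z) = -(star z * z) := by
        rw [star_mul, CliffordAlgebra.star_ι]
        calc star z * -vec v * (vec v * z) = -(star z * (vec v * vec v) * z) := by noncomm_ring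
          _ = _ := by rw [hvv, mul_one]
      have h2 : vec v * z * star (vec v * z) = -(vec v * (z * star z) * vec v) := by
        rw [star_mul, CliffordAlgebra.star_ι]
        noncomm_ring
      have hgr : ∀ i : ZMod 2, z ∈ CliffordAlgebra.evenOdd (normSq m) i →
          vec v * z ∈ CliffordAlgebra.evenOdd (normSq m) (1 + i) := fun i hi =>
        CliffordAlgebra.evenOdd_mul_le (normSq m) 1 i
          (Submodule.mul_mem_mul (CliffordAlgebra.ι_mem_evenOdd_one (normSq m) v) hi)
      rcases ih with ⟨a, b, c⟩ | ⟨a, b, c⟩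
      · have h3 := hgr 0 c
        rw [add_zero] at h3
        exact Or.inr ⟨by rw [h1, a], by rw [h2, b, mul_one, hvv], h3⟩
      · have h3 := hgr 1 c
        rw [show (1 : ZMod 2) + 1 = 0 from rfl] at h3
        exact Or.inl ⟨by rw [h1, a, neg_neg],
          by rw [h2, b, mul_neg, mul_one, neg_mul, hvv, neg_neg], h3⟩
    · rw [one_mul]; exact ih
    · rw [neg_one_mul, star_neg, neg_mul_neg, neg_mul_neg, neg_mem_iff, neg_mem_iff]; exact ih

theorem of_mem_spinGroup {m : ℕ} {x : Cl m} (hx : x ∈ spinGroup (normSq m)) :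
    x ∈ unitProds (⊤ : Submodule ℝ (Euc m)) ∧ star x * x = 1 := by
  have hs := spinGroup.star_mul_self_of_mem hx
  refine ⟨?_, hs⟩
  obtain ⟨u, hu, rfl⟩ := (spinGroup.mem_pin hx).1
  obtain ⟨c, hc, y, hy, h⟩ := exists_smul_of_mem_lipschitz hu
  have h' : Units.coeHom (Cl m) u = c • y := h
  rw [h'] at hs ⊢
  have hinj : Function.Injective (algebraMap ℝ (Cl m)) := FaithfulSMul.algebraMap_injective _ _
  rw [CliffordAlgebra.star_smul, smul_mul_smul_comm] at hs
  rcases unitProds_parity hy with ⟨a, -, -⟩ | ⟨a, -, -⟩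
  · rw [a, ← Algebra.algebraMap_eq_smul_one, ← map_one (algebraMap ℝ (Cl m))] at hs
    have : c = 1 := by nlinarith [hinj hs]
    rwa [this, one_smul]
  · rw [a, smul_neg, ← Algebra.algebraMap_eq_smul_one, ← map_neg,
      ← map_one (algebraMap ℝ (Cl m))] at hs
    nlinarith [hinj hs]

theorem mem_spinGroup {m : ℕ} [NeZero m] {x : Cl m}
    (hx : x ∈ unitProds (⊤ : Submodule ℝ (Euc m))) (hs : star x * x = 1) :
    x ∈ spinGroup (normSq m) := by
  have hinj : Function.Injective (algebraMap ℝ (Cl m)) := FaithfulSMul.algebraMap_injective _ _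
  have hunit : ∀ v : Euc m, ‖v‖ = 1 → vec v ∈
      (lipschitzGroup (normSq m)).toSubmonoid.map (Units.coeHom (Cl m)) := fun v hv =>
    ⟨⟨vec v, vec v, vec_mul_self_of_unit hv, vec_mul_self_of_unit hv⟩,
      Subgroup.subset_closure ⟨v, rfl⟩, rfl⟩
  have hle : unitProds (⊤ : Submodule ℝ (Euc m)) ≤
      (lipschitzGroup (normSq m)).toSubmonoid.map (Units.coeHom (Cl m)) := by
    refine Submonoid.closure_le.2 ?_
    rintro _ (⟨v, ⟨-, hv⟩, rfl⟩ | rfl | rfl)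
    · exact hunit v hv
    · exact one_mem _
    · have he : ‖EuclideanSpace.single (0 : Fin m) (1 : ℝ)‖ = 1 := by simp
      have := mul_mem (hunit _ he) (hunit (-EuclideanSpace.single (0 : Fin m) (1 : ℝ))
        (by simp))
      rwa [map_neg, mul_neg, vec_mul_self_of_unit he] at this
  rcases unitProds_parity hx with ⟨-, h2, h3⟩ | ⟨a, -, -⟩
  · exact ⟨⟨hle hx, ⟨hs, h2⟩⟩, h3⟩
  · rw [a, ← map_one (algebraMap ℝ (Cl m)), ← map_neg] at hs
    linarith [hinj hs]

theorem continuous_star_Cl (m : ℕ) : Continuous (star : Cl m → Cl m) := by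
  let f : Cl m →ₗ[ℝ] Cl m :=
    CliffordAlgebra.reverse ∘ₗ (CliffordAlgebra.involute (Q := normSq m)).toLinearMap
  exact IsModuleTopology.continuous_of_linearMap f

instance instCompactSpaceSpin (m : ℕ) [NeZero m] : CompactSpace (Spin m) := by
  refine isCompact_iff_compactSpace.1
    (?_ : IsCompact (spinGroup (normSq m) : Set (Cl m)))
  have : (spinGroup (normSq m) : Set (Cl m)) =
      (unitProds (⊤ : Submodule ℝ (Euc m)) : Set (Cl m)) ∩ {x | star x * x = 1} := by
    ext x
    exact ⟨fun h => of_mem_spinGroup h, fun h => mem_spinGroup h.1 h.2⟩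
  rw [this]
  exact (isCompact_unitProds m).inter_right
    (isClosed_eq ((continuous_star_Cl m).mul continuous_id) continuous_const)

instance instIsTopologicalGroupSpin (m : ℕ) : IsTopologicalGroup (Spin m) where
  continuous_mul := continuous_mul
  continuous_inv := by
    refine Continuous.subtype_mk ((continuous_star_Cl m).comp continuous_subtype_val) _

instance instMeasurableSpaceSpin (m : ℕ) : MeasurableSpace (Spin m) := borel (Spin m)

instance instBorelSpaceSpin (m : ℕ) : BorelSpace (Spin m) := ⟨rfl⟩

/-- The invariant Borel probability measure of the compact group `Spin m`. -/
def haarProb (m : ℕ) [NeZero m] : Measure (Spin m) := Measure.haarMeasure ⊤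

instance instIsProbabilityMeasureHaarProb (m : ℕ) [NeZero m] :
    IsProbabilityMeasure (haarProb m) := ⟨Measure.haarMeasure_self⟩

/-- The vector component of an element of the Clifford algebra. -/
def vecPart (m : ℕ) : Cl m →ₗ[ℝ] Euc m :=
  ExteriorAlgebra.ιInv ∘ₗ (CliffordAlgebra.equivExterior (normSq m)).toLinearMap

theorem vecPart_vec {m : ℕ} (v : Euc m) : vecPart m (vec v) = v := by
  have h : CliffordAlgebra.equivExterior (normSq m) (vec v) = ExteriorAlgebra.ι ℝ v :=
    CliffordAlgebra.changeForm_ι CliffordAlgebra.changeForm.associated_neg_proof v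
  rw [vecPart, LinearMap.comp_apply, LinearEquiv.coe_coe, h]
  exact ExteriorAlgebra.ι_leftInverse v

/-- The vector representation of the spin group: `g` sends `v` to the vector `g v g⁻¹`. -/
def rotLin {m : ℕ} (g : Spin m) : Euc m →ₗ[ℝ] Euc m :=
  vecPart m ∘ₗ LinearMap.mulLeftRight ℝ ((g : Cl m), ((g⁻¹ : Spin m) : Cl m)) ∘ₗ vec

theorem vec_rotLin {m : ℕ} (g : Spin m) (v : Euc m) :
    vec (rotLin g v) = (g : Cl m) * vec v * ((g⁻¹ : Spin m) : Cl m) := by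
  have h := spinGroup.conjAct_smul_ι_mem_range_ι (x := spinGroup.toUnits g) g.2 v
  rw [ConjAct.units_smul_def, ConjAct.ofConjAct_toConjAct] at h
  obtain ⟨w, hw⟩ := h
  have hw' : vec w = (g : Cl m) * vec v * ((g⁻¹ : Spin m) : Cl m) := hw
  rw [rotLin, LinearMap.comp_apply, LinearMap.comp_apply, LinearMap.mulLeftRight_apply,
    ← hw', vecPart_vec]

theorem vec_injective (m : ℕ) : Function.Injective (vec (m := m)) :=
  Function.LeftInverse.injective vecPart_vec

theorem coe_inv_mul_coe {m : ℕ} (g : Spin m) : ((g⁻¹ : Spin m) : Cl m) * (g : Cl m) = 1 :=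
  spinGroup.coe_star_mul_self g

theorem coe_mul_coe_inv {m : ℕ} (g : Spin m) : (g : Cl m) * ((g⁻¹ : Spin m) : Cl m) = 1 :=
  spinGroup.coe_mul_star_self g

theorem rotLin_one {m : ℕ} (v : Euc m) : rotLin (1 : Spin m) v = v :=
  vec_injective m (by rw [vec_rotLin]; simp)

theorem rotLin_mul {m : ℕ} (g h : Spin m) (v : Euc m) :
    rotLin (g * h) v = rotLin g (rotLin h v) :=
  vec_injective m (by simp only [vec_rotLin, mul_inv_rev, Submonoid.coe_mul, mul_assoc])

theorem norm_rotLin {m : ℕ} (g : Spin m) (v : Euc m) : ‖rotLin g v‖ = ‖v‖ := by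
  have hinj : Function.Injective (algebraMap ℝ (Cl m)) := FaithfulSMul.algebraMap_injective _ _
  have h : vec (rotLin g v) * vec (rotLin g v) = vec v * vec v := by
    rw [vec_rotLin]
    calc _ = (g : Cl m) * vec v * (((g⁻¹ : Spin m) : Cl m) * (g : Cl m)) * vec v *
          ((g⁻¹ : Spin m) : Cl m) := by noncomm_ring
      _ = (g : Cl m) * (vec v * vec v) * ((g⁻¹ : Spin m) : Cl m) := by
          rw [coe_inv_mul_coe]; noncomm_ring
      _ = _ := by
          rw [vec_mul_self, mul_smul_comm, smul_mul_assoc, mul_one, coe_mul_coe_inv]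
  rw [vec_mul_self, vec_mul_self, ← Algebra.algebraMap_eq_smul_one,
    ← Algebra.algebraMap_eq_smul_one] at h
  have h2 := hinj h
  rw [real_inner_self_eq_norm_sq, real_inner_self_eq_norm_sq] at h2
  exact (pow_left_inj₀ (norm_nonneg _) (norm_nonneg _) two_ne_zero).1 h2

/-- The linear isometry `v ↦ g v g⁻¹`. -/
def rotIso {m : ℕ} (g : Spin m) : Euc m ≃ₗᵢ[ℝ] Euc m where
  toLinearEquiv := LinearEquiv.ofLinearMap (rotLin g) (rotLin g⁻¹)
    (LinearMap.ext fun v => by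
      rw [LinearMap.comp_apply, ← rotLin_mul, mul_inv_cancel, rotLin_one, LinearMap.id_apply])
    (LinearMap.ext fun v => by
      rw [LinearMap.comp_apply, ← rotLin_mul, inv_mul_cancel, rotLin_one, LinearMap.id_apply])
  norm_map' := norm_rotLin g

theorem rotIso_apply {m : ℕ} (g : Spin m) (v : Euc m) : rotIso g v = rotLin g v := rfl

/-- The double covering of the rotation group by the spin group, `rot g v = g v g⁻¹`, as an action
by linear isometries. -/
def rot {m : ℕ} : Spin m →* (Euc m ≃ₗᵢ[ℝ] Euc m) where
  toFun := rotIso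
  map_one' := LinearIsometryEquiv.ext fun v => by
    rw [rotIso_apply, rotLin_one, LinearIsometryEquiv.coe_one, id_eq]
  map_mul' g h := LinearIsometryEquiv.ext fun v => by
    rw [rotIso_apply, rotLin_mul, LinearIsometryEquiv.coe_mul, Function.comp_apply, rotIso_apply,
      rotIso_apply]

theorem vec_rot {m : ℕ} (g : Spin m) (v : Euc m) :
    vec (rot g v) = (g : Cl m) * vec v * ((g⁻¹ : Spin m) : Cl m) := vec_rotLin g v

theorem rot_mul_apply {m : ℕ} (g h : Spin m) (v : Euc m) : rot (g * h) v = rot g (rot h v) :=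
  rotLin_mul g h v

theorem rot_eq_of_commute {m : ℕ} (g : Spin m) (v : Euc m)
    (h : (g : Cl m) * vec v = vec v * (g : Cl m)) : rot g v = v :=
  vec_injective m (by rw [vec_rot, h, mul_assoc, coe_mul_coe_inv, mul_one])

/-- The unit sphere `S^m` of `ℝ^(m+1)`. -/
abbrev Sph (m : ℕ) : Type := sphere (0 : Euc (m + 1)) 1

/-- The last vector of the standard basis of `ℝ^(m+1)`. -/
def lastVec (m : ℕ) : Euc (m + 1) := EuclideanSpace.single (Fin.last m) 1

theorem norm_lastVec (m : ℕ) : ‖lastVec m‖ = 1 := by simp [lastVec]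

/-- The inclusion of `ℝ^m` in `ℝ^(m+1)` as the hyperplane orthogonal to the last basis vector. -/
def incl (m : ℕ) : Euc m →ₗᵢ[ℝ] Euc (m + 1) where
  toFun v := WithLp.toLp 2 (Fin.snoc (α := fun _ => ℝ) v.ofLp 0)
  map_add' v w := by
    ext i
    refine Fin.lastCases ?_ (fun i => ?_) i <;> simp
  map_smul' c v := by
    ext i
    refine Fin.lastCases ?_ (fun i => ?_) i <;> simp
  norm_map' v := by
    simp [EuclideanSpace.norm_eq, Fin.sum_univ_castSucc]

/-- The first `m` coordinates of a vector of `ℝ^(m+1)`. -/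
def dropLast (m : ℕ) (v : Euc (m + 1)) : Euc m := WithLp.toLp 2 fun i => v i.castSucc

theorem inner_lastVec {m : ℕ} (v : Euc (m + 1)) : ⟪lastVec m, v⟫ = v (Fin.last m) := by
  simp [lastVec, EuclideanSpace.inner_single_left]

theorem incl_dropLast {m : ℕ} {v : Euc (m + 1)} (h : ⟪lastVec m, v⟫ = 0) :
    incl m (dropLast m v) = v := by
  rw [inner_lastVec] at h
  ext i
  refine Fin.lastCases ?_ (fun i => ?_) i <;> simp [incl, dropLast, h]

/-- The inclusion of `ℝ^m` in `ℝ^(m+1)` as an isometry of quadratic spaces. -/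
def inclIsometry (m : ℕ) : normSq m →qᵢ normSq (m + 1) where
  toLinearMap := (incl m).toLinearMap
  map_app' v := by
    rw [normSq_apply, normSq_apply]
    exact (incl m).inner_map_map v v

/-- The inclusion of Clifford algebras induced by that of `ℝ^m` in `ℝ^(m+1)`. -/
def clIncl (m : ℕ) : Cl m →ₐ[ℝ] Cl (m + 1) := CliffordAlgebra.map (inclIsometry m)

theorem clIncl_vec {m : ℕ} (v : Euc m) : clIncl m (vec v) = vec (incl m v) :=
  CliffordAlgebra.map_apply_ι (inclIsometry m) v

theorem clIncl_star {m : ℕ} (x : Cl m) : clIncl m (star x) = star (clIncl m x) := by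
  induction x using CliffordAlgebra.induction with
  | algebraMap r => rw [CliffordAlgebra.star_algebraMap, AlgHom.commutes,
      CliffordAlgebra.star_algebraMap]
  | ι v => rw [CliffordAlgebra.star_ι, map_neg, clIncl_vec, CliffordAlgebra.star_ι]
  | mul a b ha hb => rw [star_mul, map_mul, map_mul, star_mul, ha, hb]
  | add a b ha hb => rw [star_add, map_add, map_add, star_add, ha, hb]

theorem clIncl_mem_spinGroup {m : ℕ} (g : Spin m) :
    clIncl m g ∈ spinGroup (normSq (m + 1)) := by
  obtain ⟨h1, h2⟩ := of_mem_spinGroup g.2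
  refine mem_spinGroup ?_ (by rw [← clIncl_star, ← map_mul, h2, map_one])
  have hle : unitProds (⊤ : Submodule ℝ (Euc m)) ≤
      (unitProds (⊤ : Submodule ℝ (Euc (m + 1)))).comap (clIncl m : Cl m →* Cl (m + 1)) := by
    refine Submonoid.closure_le.2 ?_
    rintro _ (⟨v, ⟨-, hv⟩, rfl⟩ | rfl | rfl)
    · refine Submonoid.subset_closure (Or.inl ⟨incl m v, ⟨trivial, ?_⟩, (clIncl_vec v).symm⟩)
      rw [(incl m).norm_map, hv]
    · exact one_mem _
    · refine Submonoid.subset_closure (Or.inr (Or.inr ?_))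
      exact (map_neg (clIncl m) 1).trans (congrArg _ (map_one (clIncl m)))
  exact hle h1

/-- The inclusion of `Spin m` in `Spin (m+1)` induced by that of `ℝ^m` in `ℝ^(m+1)`. -/
def spinIncl (m : ℕ) : Spin m →* Spin (m + 1) where
  toFun g := ⟨clIncl m g, clIncl_mem_spinGroup g⟩
  map_one' := Subtype.ext (map_one (clIncl m))
  map_mul' g h := Subtype.ext (map_mul (clIncl m) (g : Cl m) (h : Cl m))

theorem coe_spinIncl {m : ℕ} (g : Spin m) : (spinIncl m g : Cl (m + 1)) = clIncl m g := rfl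

theorem inner_lastVec_incl {m : ℕ} (v : Euc m) : ⟪lastVec m, incl m v⟫ = 0 := by
  rw [inner_lastVec]; simp [incl]

theorem rot_spinIncl_lastVec {m : ℕ} (g : Spin m) : rot (spinIncl m g) (lastVec m) = lastVec m := by
  have key : ∀ x : Cl m, clIncl m x * vec (lastVec m) =
      vec (lastVec m) * clIncl m (CliffordAlgebra.involute x) := by
    intro x
    induction x using CliffordAlgebra.induction with
    | algebraMap r => rw [AlgHom.commutes, AlgHom.commutes, AlgHom.commutes, Algebra.commutes]
    | ι v =>
      rw [CliffordAlgebra.involute_ι, map_neg, clIncl_vec, vec_mul_swap, real_inner_comm,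
        inner_lastVec_incl, mul_zero, zero_smul, zero_sub, mul_neg]
    | mul a b ha hb => rw [map_mul, map_mul, map_mul, mul_assoc, hb, ← mul_assoc, ha, mul_assoc]
    | add a b ha hb => rw [map_add, map_add, map_add, add_mul, mul_add, ha, hb]
  refine rot_eq_of_commute _ _ ?_
  rw [coe_spinIncl, key, spinGroup.involute_eq g.2]

theorem rot_spinIncl_incl {m : ℕ} (g : Spin m) (v : Euc m) :
    rot (spinIncl m g) (incl m v) = incl m (rot g v) := by
  refine vec_injective _ ?_
  rw [vec_rot, ← map_inv, coe_spinIncl, coe_spinIncl, ← clIncl_vec, ← clIncl_vec, vec_rot,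
    map_mul, map_mul]

/-- `Spin d` as a subgroup of `Spin (d+2)`. -/
def spinSub (d : ℕ) : Subgroup (Spin (d + 2)) :=
  ((spinIncl (d + 1)).comp (spinIncl d)).range

/-- A Borel section of the bundle `Spin (m+1) → S^m`, `g ↦ g e`, where `e` is the last basis
vector, whose stabilizer is `Spin m`. -/
structure SphereSection (m : ℕ) where
  /-- The section. -/
  toFun : Sph m → Spin (m + 1)
  measurable_toFun : Measurable toFun
  rot_lastVec : ∀ x, rot (toFun x) (lastVec m) = x

/-- The first component of the projection of `Spin (d+2)` onto `S^(d+1) × S^d`. -/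
def baseCoord {d : ℕ} (g : Spin (d + 2)) : Sph (d + 1) :=
  ⟨rot g (lastVec (d + 1)), by simp [norm_lastVec]⟩

/-- The second component: the rotation `s(x)⁻¹ g`, where `x = g e`, fixes `e`, and sends the
penultimate basis vector to a unit vector orthogonal to `e`. -/
def fibreCoord {d : ℕ} (s : SphereSection (d + 1)) (g : Spin (d + 2)) : Sph d :=
  ⟨dropLast (d + 1) (rot ((s.toFun (baseCoord g))⁻¹ * g) (incl (d + 1) (lastVec d))), by
    have h1 : rot ((s.toFun (baseCoord g))⁻¹ * g) (lastVec (d + 1)) = lastVec (d + 1) := by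
      rw [rot_mul_apply]
      have h : rot g (lastVec (d + 1)) = rot (s.toFun (baseCoord g)) (lastVec (d + 1)) :=
        (s.rot_lastVec (baseCoord g)).symm
      rw [h, ← rot_mul_apply, inv_mul_cancel, map_one, LinearIsometryEquiv.coe_one, id_eq]
    have h2 : ⟪lastVec (d + 1), rot ((s.toFun (baseCoord g))⁻¹ * g) (incl (d + 1) (lastVec d))⟫
        = 0 := by
      conv_lhs => rw [← h1]
      rw [LinearIsometryEquiv.inner_map_map, inner_lastVec_incl]
    rw [mem_sphere_zero_iff_norm, ← (incl (d + 1)).norm_map, incl_dropLast h2,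
      LinearIsometryEquiv.norm_map, LinearIsometry.norm_map, norm_lastVec]⟩

/-- The identification of the homogeneous space `Spin (d+2) / Spin d` with `S^(d+1) × S^d` given
by a section: the class of `g` corresponds to `(x, y)`, where `x = g e` and `s(x) y = g e'` for the
last and the penultimate basis vectors `e` and `e'`. -/
def toSpheres {d : ℕ} (s : SphereSection (d + 1)) :
    Spin (d + 2) ⧸ spinSub d → Sph (d + 1) × Sph d :=
  Quotient.lift (fun g => (baseCoord g, fibreCoord s g)) (by
    intro g g' hgg
    have hmem : g⁻¹ * g' ∈ spinSub d := QuotientGroup.leftRel_apply.1 hgg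
    obtain ⟨h, hh⟩ := hmem
    obtain rfl : g * spinIncl (d + 1) (spinIncl d h) = g' := by
      rw [← MonoidHom.comp_apply, hh, mul_inv_cancel_left]
    have h1 : baseCoord (g * spinIncl (d + 1) (spinIncl d h)) = baseCoord g :=
      Subtype.ext (by
        change rot _ _ = rot _ _
        rw [rot_mul_apply, rot_spinIncl_lastVec])
    refine Prod.ext h1.symm (Subtype.ext ?_)
    change dropLast _ _ = dropLast _ _
    rw [h1, ← mul_assoc, rot_mul_apply _ (spinIncl (d + 1) (spinIncl d h)), rot_spinIncl_incl,
      rot_spinIncl_lastVec])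

/-- The product in `S^(d+1) × S^d` of the equators with poles `p` and `q`. -/
def biEquator {d : ℕ} (p : Sph (d + 1)) (q : Sph d) : Set (Sph (d + 1) × Sph d) :=
  {b | ⟪(p : Euc (d + 2)), (b.1 : Euc (d + 2))⟫ = 0 ∧ ⟪(q : Euc (d + 1)), (b.2 : Euc (d + 1))⟫ = 0}

/-- The preimage in `Spin (d+2)` of a bi-equator of `S^(d+1) × S^d`. -/
def biEquatorLocus {d : ℕ} (s : SphereSection (d + 1)) (p : Sph (d + 1)) (q : Sph d) :
    Set (Spin (d + 2)) :=
  {g | toSpheres s (g : Spin (d + 2) ⧸ spinSub d) ∈ biEquator p q}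

/-- The rotation matrix of `g`, by columns, in the norm `‖A‖² = Tr (Aᵀ A) / 2`. -/
def frame {m : ℕ} (g : Spin m) : PiLp 2 (fun _ : Fin m => Euc m) :=
  WithLp.toLp 2 fun i => (√2)⁻¹ • rot g (EuclideanSpace.single i 1)

/-- The distance on `Spin m` of the bi-invariant Riemannian metric in the standard normalization,
`-Tr (R⁻¹dR ⊗ R⁻¹dR) / 2` where `R` is the rotation matrix, in which the rotations of a plane by
an angle `θ` form a curve of speed one: the infimum of the lengths of the curves from `g` to `h`.
It is infinite where there is no curve. -/
def spinEDist {m : ℕ} (g h : Spin m) : ℝ≥0∞ :=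
  ⨅ γ : Path g h, eVariationOn (fun t => frame (γ t)) univ

/-- The tube of radius `ε` about a subset of `Spin m`. -/
def tube {m : ℕ} (ε : ℝ) (A : Set (Spin m)) : Set (Spin m) :=
  {g | ∃ a ∈ A, spinEDist g a < ENNReal.ofReal ε}

/-- The product of two unit vectors. -/
def rotor {m : ℕ} [NeZero m] (u v : sphere (0 : Euc m) 1) : Spin m :=
  ⟨vec (u : Euc m) * vec (v : Euc m), by
    have hu : ‖(u : Euc m)‖ = 1 := by simp
    have hv : ‖(v : Euc m)‖ = 1 := by simp
    refine mem_spinGroup (mul_mem (Submonoid.subset_closure (Or.inl ⟨u, ⟨trivial, hu⟩, rfl⟩))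
      (Submonoid.subset_closure (Or.inl ⟨v, ⟨trivial, hv⟩, rfl⟩))) ?_
    rw [star_mul, CliffordAlgebra.star_ι, CliffordAlgebra.star_ι]
    calc -vec (v : Euc m) * -vec (u : Euc m) * (vec (u : Euc m) * vec (v : Euc m))
        = vec (v : Euc m) * (vec (u : Euc m) * vec (u : Euc m)) * vec (v : Euc m) := by
          noncomm_ring
      _ = 1 := by rw [vec_mul_self_of_unit hu, mul_one, vec_mul_self_of_unit hv]⟩

theorem coe_rotor_inv {m : ℕ} [NeZero m] (u v : sphere (0 : Euc m) 1) :
    (((rotor u v)⁻¹ : Spin m) : Cl m) = vec (v : Euc m) * vec (u : Euc m) := by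
  change star (vec (u : Euc m) * vec (v : Euc m)) = _
  rw [star_mul, CliffordAlgebra.star_ι, CliffordAlgebra.star_ι, neg_mul_neg]

theorem rot_rotor {m : ℕ} [NeZero m] (u v : sphere (0 : Euc m) 1) :
    rot (rotor u v) (v : Euc m) = (2 * ⟪(u : Euc m), (v : Euc m)⟫) • (u : Euc m) - (v : Euc m) := by
  refine vec_injective m ?_
  have hu : ‖(u : Euc m)‖ = 1 := by simp
  have hv : ‖(v : Euc m)‖ = 1 := by simp
  rw [vec_rot, coe_rotor_inv]
  change vec (u : Euc m) * vec (v : Euc m) * vec (v : Euc m) * (vec (v : Euc m) * vec (u : Euc m))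
    = _
  calc _ = vec (u : Euc m) * (vec (v : Euc m) * vec (v : Euc m)) * (vec (v : Euc m) *
        vec (u : Euc m)) := by noncomm_ring
    _ = vec (u : Euc m) * vec (v : Euc m) * vec (u : Euc m) := by
        rw [vec_mul_self_of_unit hv, mul_one, mul_assoc]
    _ = _ := by
        rw [vec_mul_swap, sub_mul, mul_assoc, vec_mul_self_of_unit hu, mul_one, smul_mul_assoc,
          one_mul, map_sub, map_smul]

/-- The direction of `x + e`, and the first basis vector if `x = -e`. -/
def halfway {d : ℕ} (x : Sph (d + 1)) : Sph (d + 1) :=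
  open Classical in
  if h : (x : Euc (d + 2)) + lastVec (d + 1) = 0 then ⟨EuclideanSpace.single 0 1, by simp⟩
  else ⟨‖(x : Euc (d + 2)) + lastVec (d + 1)‖⁻¹ • ((x : Euc (d + 2)) + lastVec (d + 1)), by
    rw [mem_sphere_zero_iff_norm, norm_smul, norm_inv, norm_norm,
      inv_mul_cancel₀ (norm_ne_zero_iff.2 h)]⟩

instance instNonemptySphereSection (d : ℕ) : Nonempty (SphereSection (d + 1)) := by
  let e : Sph (d + 1) := ⟨lastVec (d + 1), by simp [norm_lastVec]⟩
  refine ⟨⟨fun x => rotor (halfway x) e, ?_, ?_⟩⟩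
  · have hne : ∀ x : Sph (d + 1), x ∈ ({-e}ᶜ : Set _) → (x : Euc (d + 2)) + lastVec (d + 1) ≠ 0 := by
      intro x hx h
      exact hx (Subtype.ext (eq_neg_of_add_eq_zero_left h))
    refine measurable_of_continuousOn_compl_singleton (-e) ?_
    have hc : Continuous fun v : Euc (d + 2) => (vec v : Cl (d + 2)) :=
      LinearMap.continuous_of_finiteDimensional _
    refine continuousOn_iff_continuous_domRestrict.2 (Continuous.subtype_mk ?_ _)
    refine Continuous.mul (hc.comp ?_) continuous_const
    have heq : (fun x : ({-e}ᶜ : Set (Sph (d + 1))) => (halfway x.1 : Euc (d + 2))) =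
        fun x => ‖(x.1 : Euc (d + 2)) + lastVec (d + 1)‖⁻¹ •
          ((x.1 : Euc (d + 2)) + lastVec (d + 1)) := by
      funext x
      rw [halfway, dif_neg (hne x.1 x.2)]
    rw [heq]
    have h1 : Continuous fun x : ({-e}ᶜ : Set (Sph (d + 1))) =>
        (x.1 : Euc (d + 2)) + lastVec (d + 1) := by fun_prop
    exact (h1.norm.inv₀ fun x => norm_ne_zero_iff.2 (hne x.1 x.2)).smul h1
  · intro x
    have hr := rot_rotor (halfway x) e
    change rot (rotor (halfway x) e) (lastVec (d + 1)) = _ at hr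
    rw [hr]
    change (2 * ⟪(halfway x : Euc (d + 2)), lastVec (d + 1)⟫) • (halfway x : Euc (d + 2)) -
      lastVec (d + 1) = x
    by_cases h : (x : Euc (d + 2)) + lastVec (d + 1) = 0
    · rw [halfway, dif_pos h]
      rw [real_inner_comm, inner_lastVec]
      have h0 : (EuclideanSpace.single (0 : Fin (d + 2)) (1 : ℝ)) (Fin.last (d + 1)) = 0 := by
        simp [Fin.ext_iff]
      change (2 * (EuclideanSpace.single (0 : Fin (d + 2)) (1 : ℝ)) (Fin.last (d + 1))) • _ - _ = _
      rw [h0, mul_zero, zero_smul, zero_sub]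
      exact (eq_neg_of_add_eq_zero_left h).symm
    · rw [halfway, dif_neg h]
      set w := (x : Euc (d + 2)) + lastVec (d + 1) with hw
      have hwn : ‖w‖ ≠ 0 := norm_ne_zero_iff.2 h
      have hx1 : ‖(x : Euc (d + 2))‖ = 1 := by simp
      have h2 : 2 * ⟪w, lastVec (d + 1)⟫ = ‖w‖ ^ 2 := by
        rw [← real_inner_self_eq_norm_sq, hw]
        simp only [inner_add_left, inner_add_right, real_inner_self_eq_norm_sq, hx1,
          norm_lastVec, real_inner_comm (x : Euc (d + 2)) (lastVec (d + 1))]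
        ring
      change (2 * ⟪‖w‖⁻¹ • w, lastVec (d + 1)⟫) • (‖w‖⁻¹ • w) - lastVec (d + 1) = x
      rw [real_inner_smul_left, mul_left_comm, h2, smul_smul,
        show ‖w‖⁻¹ * ‖w‖ ^ 2 * ‖w‖⁻¹ = 1 by field_simp, one_smul, hw, add_sub_cancel_right]

end

end SpinBundle

open SpinBundle

namespace SpinBundle

/-! The bijection says that the spin group is transitive on spheres and that stabilizers are the
smaller spin groups. For the stabilizer of `e`, `unitProds_subset_mul` writes an element as `u * a`,
with `u` a unit vector or a sign and `a` a product of unit vectors orthogonal to `e` and of signs.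
If `u` is a vector, then `a` is odd and anticommutes with `e`; since `u * a` commutes with `e`, `u`
is orthogonal to `e` as well (`mem_range_spinIncl`). Where `s` is continuous, the inverse is
continuous because its composite with the quotient map `(x, h) ↦ (x, h e')` is the class of `s(x)
h`.

Concentration needs only second moments. By right invariance `⟪p, g e⟫` and `⟪p, g b⟫` have the same
distribution for all unit vectors `b`; by Bessel the mean of the square is at most `1/(2n+1)`, and
Chebyshev applies. This survives when the fixed vector is replaced by `w (g e)`: translations by the
stabilizer of `e` keep `g e` and carry `e'` to every basis vector of the orthogonal of `e`, so the
mean of `⟪w (g e), g e'⟫ ^ 2` is at most `1/(2n)` (`haarProb_le_abs_inner_rot_le`). With `w x = s(x)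
q` this inner product is `⟪q, y⟫`, and projecting `x` and `y` to their equators settles the
neighbourhood in the base.

For the tube in the group, `s` may jump, so moving `x` to the equator may change `y` by a large
amount. The remedy is the choice of `w`. Let `x'` be the point of the equator nearest to `x` and `k`
the small rotation taking `x` to `x'`. Both depend on `x` only, so `w x = k⁻¹ s(x') q` is
admissible: with high probability `k g e'` is almost orthogonal to `s(x') q`. A second small
rotation, fixing `x'`, makes it orthogonal (`exists_mem_biEquatorLocus_spinEDist_le`). Each of the
two rotations moves in a plane, so its cost in the Riemannian distance is bounded independently of
the dimension (`dist_frame_rotor_mul_le`). -/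

/-! ### The action on vectors: continuity, transitivity, stabilizers -/

theorem continuous_vec (m : ℕ) : Continuous fun v : Euc m => (vec v : Cl m) :=
  LinearMap.continuous_of_finiteDimensional _

theorem continuous_rot (m : ℕ) : Continuous fun z : Spin m × Euc m => rot z.1 z.2 := by
  have h1 : Continuous (vecPart m) := IsModuleTopology.continuous_of_linearMap (vecPart m)
  have h2 : Continuous fun z : Spin m × Euc m =>
      (z.1 : Cl m) * vec z.2 * ((z.1⁻¹ : Spin m) : Cl m) :=
    ((continuous_subtype_val.comp continuous_fst).mul
      ((continuous_vec m).comp continuous_snd)).mul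
      (continuous_subtype_val.comp (continuous_inv.comp continuous_fst))
  exact h1.comp h2

theorem continuous_rot_apply {m : ℕ} (v : Euc m) : Continuous fun g : Spin m => rot g v :=
  (continuous_rot m).comp (f := fun g : Spin m => (g, v)) (continuous_id.prodMk continuous_const)

theorem rot_inv_apply_apply {m : ℕ} (g : Spin m) (v : Euc m) : rot g⁻¹ (rot g v) = v := by
  rw [← rot_mul_apply, inv_mul_cancel, map_one, LinearIsometryEquiv.coe_one, id_eq]

theorem rot_apply_inv_apply {m : ℕ} (g : Spin m) (v : Euc m) : rot g (rot g⁻¹ v) = v := by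
  rw [← rot_mul_apply, mul_inv_cancel, map_one, LinearIsometryEquiv.coe_one, id_eq]

theorem inner_rot_inv {m : ℕ} (g : Spin m) (v w : Euc m) : ⟪rot g⁻¹ v, w⟫ = ⟪v, rot g w⟫ := by
  rw [← (rot g).inner_map_map, rot_apply_inv_apply]

/-- The spin group acts transitively on the unit sphere. -/
theorem exists_rot_eq {d : ℕ} {v w : Euc (d + 2)} (hv : ‖v‖ = 1) (hw : ‖w‖ = 1) :
    ∃ g : Spin (d + 2), rot g v = w := by
  obtain ⟨s⟩ := instNonemptySphereSection d
  have h1 := s.rot_lastVec ⟨v, by simpa using hv⟩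
  have h2 := s.rot_lastVec ⟨w, by simpa using hw⟩
  refine ⟨s.toFun ⟨w, by simpa using hw⟩ * (s.toFun ⟨v, by simpa using hv⟩)⁻¹, ?_⟩
  have h3 := rot_inv_apply_apply (s.toFun ⟨v, by simpa using hv⟩) (lastVec (d + 1))
  rw [h1] at h3
  rw [rot_mul_apply, h3, h2]

theorem exists_clIncl_eq {m : ℕ} {x : Cl (m + 1)} (hx : x ∈ unitProds (ℝ ∙ lastVec m)ᗮ) :
    ∃ y ∈ unitProds (⊤ : Submodule ℝ (Euc m)), clIncl m y = x := by
  have hle : unitProds (ℝ ∙ lastVec m)ᗮ ≤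
      (unitProds (⊤ : Submodule ℝ (Euc m))).map (clIncl m : Cl m →* Cl (m + 1)) := by
    refine Submonoid.closure_le.2 ?_
    rintro _ (⟨v, ⟨hv, hv1⟩, rfl⟩ | rfl | rfl)
    · rw [Submodule.mem_orthogonal_singleton_iff_inner_right] at hv
      refine ⟨vec (dropLast m v), Submonoid.subset_closure (Or.inl ⟨_, ⟨trivial, ?_⟩, rfl⟩), ?_⟩
      · rw [← (incl m).norm_map, incl_dropLast hv, hv1]
      · exact (clIncl_vec _).trans (by rw [incl_dropLast hv])
    · exact one_mem _
    · exact ⟨-1, Submonoid.subset_closure (Or.inr (Or.inr rfl)),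
        (map_neg (clIncl m) 1).trans (congrArg _ (map_one (clIncl m)))⟩
  exact hle hx

theorem algebraMap_Cl_injective (m : ℕ) : Function.Injective (algebraMap ℝ (Cl m)) :=
  FaithfulSMul.algebraMap_injective _ _

theorem neg_one_ne_one_Cl (m : ℕ) : (-1 : Cl m) ≠ 1 := by
  intro h
  rw [← map_one (algebraMap ℝ (Cl m)), ← map_neg] at h
  linarith [algebraMap_Cl_injective m h]

/-- A preimage `y` under `clIncl` has `star y * y = ±1`. The sign `-1` is excluded because `clIncl`
commutes with `star` and `-1 ≠ 1` in the larger algebra. -/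
theorem mem_range_spinIncl_of_mem_unitProds {m : ℕ} [NeZero m] {g : Spin (m + 1)}
    (hg : (g : Cl (m + 1)) ∈ unitProds (ℝ ∙ lastVec m)ᗮ) : g ∈ (spinIncl m).range := by
  obtain ⟨y, hy, h⟩ := exists_clIncl_eq hg
  have hs : star y * y = 1 := by
    rcases unitProds_parity hy with ⟨h1, -, -⟩ | ⟨h1, -, -⟩
    · exact h1
    · have h2 := congrArg (clIncl m) h1
      rw [map_mul, clIncl_star, h, (of_mem_spinGroup g.2).2, map_neg, map_one] at h2
      exact absurd h2.symm (neg_one_ne_one_Cl _)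
  exact ⟨⟨y, mem_spinGroup hy hs⟩, Subtype.ext h⟩

/-- Each vector orthogonal to `e` anticommutes with `e`; `involute` keeps count of the signs. -/
theorem unitProds_mul_swap {m : ℕ} {e : Euc m} {x : Cl m} (hx : x ∈ unitProds (ℝ ∙ e)ᗮ) :
    x * vec e = vec e * CliffordAlgebra.involute x := by
  induction hx using Submonoid.closure_induction_left with
  | one => simp
  | mul_left y hy z hz ih =>
    rw [map_mul, mul_assoc, ih, ← mul_assoc, ← mul_assoc]
    congr 1
    rcases hy with ⟨v, ⟨hv, hv1⟩, rfl⟩ | rfl | rfl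
    · rw [Submodule.mem_orthogonal_singleton_iff_inner_left] at hv
      rw [CliffordAlgebra.involute_ι, vec_mul_swap, hv]
      simp
    · simp
    · simp

/-- The stabilizer of the last basis vector in `Spin (m+1)` is `Spin m`. -/
theorem mem_range_spinIncl {m : ℕ} [NeZero m] {g : Spin (m + 1)}
    (hg : rot g (lastVec m) = lastVec m) : g ∈ (spinIncl m).range := by
  refine mem_range_spinIncl_of_mem_unitProds ?_
  obtain ⟨hgu, hgs⟩ := of_mem_spinGroup g.2
  have h := unitProds_subset_mul (lastVec m) hgu
  rw [top_inf_eq] at h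
  obtain ⟨u, hu, a, ha, hua⟩ := h
  change u * a = (g : Cl (m + 1)) at hua
  rcases hu with ⟨v, ⟨-, hv1⟩, rfl⟩ | rfl | rfl
  · rw [← hua]
    refine mul_mem (Submonoid.subset_closure (Or.inl ⟨v, ⟨?_, hv1⟩, rfl⟩)) ha
    rw [Submodule.mem_orthogonal_singleton_iff_inner_left]
    have hvv := vec_mul_self_of_unit hv1
    -- This is `g e = e g`, from `g e g⁻¹ = e`.
    have hcomm : vec v * a * vec (lastVec m) = vec (lastVec m) * (vec v * a) := by
      have := congrArg vec hg
      rw [vec_rot] at this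
      rw [hua]
      conv_rhs => rw [← this, mul_assoc, coe_inv_mul_coe, mul_one]
    -- The product `v * a` is even and `v` is odd and invertible, so `a` is odd.
    have hinv : CliffordAlgebra.involute a = -a := by
      have h1 := spinGroup.involute_eq g.2
      rw [← hua, map_mul, CliffordAlgebra.involute_ι] at h1
      have h2 := congrArg (vec v * ·) h1
      simp only [← mul_assoc, mul_neg, neg_mul, hvv, one_mul] at h2
      exact neg_eq_iff_eq_neg.1 h2
    have haa : a * star a = 1 ∨ a * star a = -1 := by
      rcases unitProds_parity (Submonoid.closure_mono (unitVecs_mono le_top) ha) with h | h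
      · exact Or.inl h.2.1
      · exact Or.inr h.2.1
    rw [mul_assoc, unitProds_mul_swap ha, hinv, ← mul_assoc (vec (lastVec m)), mul_neg,
      mul_neg, ← mul_assoc] at hcomm
    -- Moving `e` past the odd factor `a` and cancelling `a`, invertible since `a * star a = ±1`,
    -- leaves that `v` anticommutes with `e`, that is, `v` is orthogonal to `e`.
    have h3 : -(vec v * vec (lastVec m)) = vec (lastVec m) * vec v := by
      have h4 := congrArg (· * star a) hcomm
      simp only [neg_mul, mul_assoc _ a] at h4
      rcases haa with h | h <;> rw [h] at h4
      · simpa using h4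
      · simpa using congrArg Neg.neg h4
    rw [vec_mul_swap v, neg_sub, sub_eq_self, smul_eq_zero] at h3
    rcases h3 with h3 | h3
    · linarith
    · exact absurd h3 one_ne_zero
  · rw [← hua, one_mul]; exact ha
  · rw [← hua]
    exact mul_mem (Submonoid.subset_closure (Or.inr (Or.inr rfl))) ha

/-! ### The homogeneous space as a product of spheres -/

variable {d : ℕ}

theorem continuous_baseCoord : Continuous (baseCoord (d := d)) :=
  Continuous.subtype_mk (continuous_rot_apply _) _

theorem inner_lastVec_rot_section (s : SphereSection (d + 1)) (g : Spin (d + 2)) :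
    ⟪lastVec (d + 1),
      rot ((s.toFun (baseCoord g))⁻¹ * g) (incl (d + 1) (lastVec d))⟫ = 0 := by
  have h1 : rot ((s.toFun (baseCoord g))⁻¹ * g) (lastVec (d + 1)) = lastVec (d + 1) := by
    rw [rot_mul_apply]
    have h : rot g (lastVec (d + 1)) = rot (s.toFun (baseCoord g)) (lastVec (d + 1)) :=
      (s.rot_lastVec (baseCoord g)).symm
    rw [h, rot_inv_apply_apply]
  conv_lhs => rw [← h1]
  rw [LinearIsometryEquiv.inner_map_map, inner_lastVec_incl]

theorem rot_section_fibreCoord (s : SphereSection (d + 1)) (g : Spin (d + 2)) :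
    rot (s.toFun (baseCoord g)) (incl (d + 1) (fibreCoord s g)) =
      rot g (incl (d + 1) (lastVec d)) := by
  change rot _ (incl (d + 1) (dropLast (d + 1) _)) = _
  rw [incl_dropLast (inner_lastVec_rot_section s g), rot_mul_apply, rot_apply_inv_apply]

theorem fibreCoord_eq {s : SphereSection (d + 1)} {g : Spin (d + 2)} {y : Sph d}
    (h : rot (s.toFun (baseCoord g)) (incl (d + 1) y) = rot g (incl (d + 1) (lastVec d))) :
    fibreCoord s g = y := by
  rw [← rot_section_fibreCoord s g] at h
  exact Subtype.ext ((incl (d + 1)).injective ((rot _).injective h)).symm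

theorem toSpheres_mk (s : SphereSection (d + 1)) (g : Spin (d + 2)) :
    toSpheres s (g : Spin (d + 2) ⧸ spinSub d) = (baseCoord g, fibreCoord s g) := rfl

/-- An element of `Spin (d+2)` over the point `(x, y)`, where `y` is the image of the last basis
vector by `h`. -/
theorem toSpheres_section_mul (s : SphereSection (d + 1)) (x : Sph (d + 1)) (h : Spin (d + 1)) :
    toSpheres s ((s.toFun x * spinIncl (d + 1) h : Spin (d + 2)) : Spin (d + 2) ⧸ spinSub d) =
      (x, ⟨rot h (lastVec d), by simp [norm_lastVec]⟩) := by
  have h1 : baseCoord (s.toFun x * spinIncl (d + 1) h) = x := Subtype.ext (by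
    change rot _ _ = _
    rw [rot_mul_apply, rot_spinIncl_lastVec, s.rot_lastVec])
  rw [toSpheres_mk]
  refine Prod.ext h1 (fibreCoord_eq ?_)
  rw [h1, rot_mul_apply, rot_spinIncl_incl]

theorem toSpheres_surjective (s : SphereSection (d + 2)) : Function.Surjective (toSpheres s) := by
  rintro ⟨x, y⟩
  obtain ⟨h, hh⟩ := exists_rot_eq (norm_lastVec (d + 1)) (w := (y : Euc (d + 2))) (by simp)
  exact ⟨_, (toSpheres_section_mul s x h).trans (Prod.ext rfl (Subtype.ext hh))⟩

/-- The stabilizer theorem is used twice: `g⁻¹ * g'` fixes `e`, so it comes from some `k` one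
dimension lower, and `k` fixes the last basis vector there. -/
theorem toSpheres_injective [NeZero d] (s : SphereSection (d + 1)) :
    Function.Injective (toSpheres s) := by
  intro a b
  induction a using QuotientGroup.induction_on with | H g => ?_
  induction b using QuotientGroup.induction_on with | H g' => ?_
  rw [toSpheres_mk, toSpheres_mk, Prod.mk.injEq]
  rintro ⟨h1, h2⟩
  refine QuotientGroup.eq.2 ?_
  have h3 : rot g (incl (d + 1) (lastVec d)) = rot g' (incl (d + 1) (lastVec d)) := by
    rw [← rot_section_fibreCoord s g, ← rot_section_fibreCoord s g', h1, h2]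
  have h4 : rot g (lastVec (d + 1)) = rot g' (lastVec (d + 1)) := congrArg Subtype.val h1
  obtain ⟨k, hk⟩ := mem_range_spinIncl (g := g⁻¹ * g') (by
    rw [rot_mul_apply, ← h4, rot_inv_apply_apply])
  obtain ⟨l, hl⟩ := mem_range_spinIncl (g := k) (by
    refine (incl (d + 1)).injective ?_
    rw [← rot_spinIncl_incl, hk, rot_mul_apply, ← h3, rot_inv_apply_apply])
  exact ⟨l, by rw [MonoidHom.comp_apply, hl, hk]⟩

theorem toSpheres_bijective (s : SphereSection (d + 2)) : Function.Bijective (toSpheres s) :=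
  ⟨toSpheres_injective s, toSpheres_surjective s⟩

theorem continuous_spinIncl (m : ℕ) : Continuous (spinIncl m) :=
  Continuous.subtype_mk ((IsModuleTopology.continuous_of_linearMap
    (clIncl m).toLinearMap).comp continuous_subtype_val) _

theorem continuous_dropLast (m : ℕ) : Continuous (dropLast m) := by
  unfold dropLast
  fun_prop

theorem continuousOn_toSpheres (s : SphereSection (d + 1)) {U : Set (Sph (d + 1))} (hU : IsOpen U)
    (hs : ContinuousOn s.toFun U) :
    ContinuousOn (toSpheres s) {b | (toSpheres s b).1 ∈ U} := by
  intro a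
  induction a using QuotientGroup.induction_on with | H g => ?_
  intro hg
  refine ContinuousAt.continuousWithinAt ?_
  -- Neighbourhoods in the quotient are images of neighbourhoods in the group, so continuity is
  -- checked on representatives.
  rw [ContinuousAt, QuotientGroup.nhds_eq, tendsto_map'_iff]
  have hb : ContinuousAt (baseCoord (d := d)) g := continuous_baseCoord.continuousAt
  have hsg : ContinuousAt (fun g => s.toFun (baseCoord g)) g :=
    ContinuousAt.comp (g := s.toFun) (hs.continuousAt (hU.mem_nhds hg)) hb
  refine ContinuousAt.prodMk (f := baseCoord) (g := fibreCoord s) hb ?_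
  refine Topology.IsInducing.subtypeVal.continuousAt_iff.2 ?_
  exact ContinuousAt.comp (g := dropLast (d + 1)) (continuous_dropLast _).continuousAt
    ((continuous_rot_apply _).continuousAt.comp (hsg.inv.mul continuousAt_id))

/-- By compactness of the spin group, `h ↦ h e'` is proper, and it stays proper after a product with
the identity of `U`. A proper surjection is a quotient map, so continuity may be tested on `U` times
the spin group, where the inverse lifts to `s(x) h`. -/
theorem continuousOn_toSpheres_symm (s : SphereSection (d + 2)) {U : Set (Sph (d + 2))}
    (hs : ContinuousOn s.toFun U) :
    ContinuousOn (Equiv.ofBijective _ (toSpheres_bijective s)).symm (U ×ˢ univ) := by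
  let φ : Spin (d + 2) → Sph (d + 1) := fun h => ⟨rot h (lastVec (d + 1)), by simp [norm_lastVec]⟩
  have hφ : Continuous φ := Continuous.subtype_mk (continuous_rot_apply _) _
  have hsurj : Function.Surjective φ := fun y => by
    obtain ⟨h, hh⟩ := exists_rot_eq (norm_lastVec (d + 1)) (w := (y : Euc (d + 2))) (by simp)
    exact ⟨h, Subtype.ext hh⟩
  have hprop : IsProperMap (Prod.map (id : U → U) φ) :=
    (isProperMap_id (X := U)).prodMap hφ.isProperMap
  have hquot := hprop.isClosedMap.isQuotientMap hprop.continuous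
    (Function.surjective_id.prodMap hsurj)
  have hcont : Continuous fun z : U × Sph (d + 1) =>
      (Equiv.ofBijective _ (toSpheres_bijective s)).symm ((z.1 : Sph (d + 2)), z.2) := by
    refine hquot.continuous_iff.2 ?_
    have heq : (fun z : U × Sph (d + 1) =>
        (Equiv.ofBijective _ (toSpheres_bijective s)).symm ((z.1 : Sph (d + 2)), z.2)) ∘
          Prod.map (id : U → U) φ = fun z : U × Spin (d + 2) =>
        ((s.toFun z.1 * spinIncl (d + 2) z.2 : Spin (d + 3)) :
          Spin (d + 3) ⧸ spinSub (d + 1)) := by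
      funext z
      exact (Equiv.symm_apply_eq _).2 (toSpheres_section_mul s z.1 z.2).symm
    rw [heq]
    exact continuous_quotient_mk'.comp
      (((continuousOn_iff_continuous_domRestrict.1 hs).comp continuous_fst).mul
        ((continuous_spinIncl _).comp continuous_snd))
  rw [continuousOn_iff_continuous_domRestrict]
  exact hcont.comp (f := fun z : (U ×ˢ univ : Set (Sph (d + 2) × Sph (d + 1))) =>
    ((⟨z.1.1, z.2.1⟩ : U), z.1.2)) (by fun_prop)

/-- Over an open set on which the section is continuous, the identification of
`Spin (d+3) / Spin (d+1)` with the product of spheres is a homeomorphism. -/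
noncomputable def toSpheresHomeomorph (s : SphereSection (d + 2)) {U : Set (Sph (d + 2))}
    (hU : IsOpen U) (hs : ContinuousOn s.toFun U) :
    OpenPartialHomeomorph (Spin (d + 3) ⧸ spinSub (d + 1)) (Sph (d + 2) × Sph (d + 1)) where
  toFun := toSpheres s
  invFun := (Equiv.ofBijective _ (toSpheres_bijective s)).symm
  source := {b | (toSpheres s b).1 ∈ U}
  target := U ×ˢ univ
  map_source' b hb := ⟨hb, trivial⟩
  map_target' z hz := by
    have := (Equiv.ofBijective _ (toSpheres_bijective s)).apply_symm_apply z
    rw [Equiv.ofBijective_apply] at this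
    rw [mem_ofPred_eq, this]
    exact hz.1
  left_inv' b _ := (Equiv.ofBijective _ (toSpheres_bijective s)).symm_apply_apply b
  right_inv' z _ := (Equiv.ofBijective _ (toSpheres_bijective s)).apply_symm_apply z
  open_source := by
    have : IsOpen ((fun g : Spin (d + 3) => (baseCoord g : Sph (d + 2))) ⁻¹' U) :=
      hU.preimage continuous_baseCoord
    exact (QuotientGroup.isOpenQuotientMap_mk (N := spinSub (d + 1))).isQuotientMap.isOpen_preimage.1 this
  open_target := hU.prod isOpen_univ
  continuousOn_toFun := continuousOn_toSpheres s hU hs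
  continuousOn_invFun := continuousOn_toSpheres_symm s hs

/-! ### Equators and bi-equators -/

/-- The equator of `S^(m+1)` is the image of `S^m` by an isometry. -/
theorem exists_isometry_equator {m : ℕ} (p : Sph (m + 1)) :
    ∃ f : Sph m → Sph (m + 1), Isometry f ∧
      range f = {x : Sph (m + 1) | ⟪(p : Euc (m + 2)), (x : Euc (m + 2))⟫ = 0} := by
  obtain ⟨g, hg⟩ := exists_rot_eq (norm_lastVec (m + 1)) (w := (p : Euc (m + 2))) (by simp)
  refine ⟨fun y => ⟨rot g (incl (m + 1) y), by simp⟩, ?_, ?_⟩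
  · exact Isometry.of_dist_eq fun y z => ((rot g).isometry.comp (incl (m + 1)).isometry).dist_eq y z
  · refine Subset.antisymm ?_ ?_
    · rintro _ ⟨y, rfl⟩
      rw [mem_ofPred_eq, ← hg, LinearIsometryEquiv.inner_map_map, inner_lastVec_incl]
    · intro x hx
      rw [mem_ofPred_eq, ← hg, real_inner_comm, ← rot_apply_inv_apply g (x : Euc (m + 2)),
        LinearIsometryEquiv.inner_map_map, real_inner_comm] at hx
      have h := incl_dropLast hx
      refine ⟨⟨dropLast (m + 1) (rot g⁻¹ x), ?_⟩, Subtype.ext ?_⟩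
      · rw [mem_sphere_zero_iff_norm, ← (incl (m + 1)).norm_map, h, LinearIsometryEquiv.norm_map]
        simp
      · change rot g (incl (m + 1) _) = _
        rw [h, rot_apply_inv_apply]

/-- The bi-equator is isometric to a product of spheres. -/
theorem nonempty_biEquator_isometryEquiv {d : ℕ} (p : Sph (d + 2)) (q : Sph (d + 1)) :
    Nonempty (biEquator p q ≃ᵢ Sph (d + 1) × Sph d) := by
  obtain ⟨f, hf, hfr⟩ := exists_isometry_equator p
  obtain ⟨f', hf', hfr'⟩ := exists_isometry_equator q
  have h : range (Prod.map f f') = biEquator p q := by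
    rw [range_prodMap, hfr, hfr']
    rfl
  rw [← h]
  exact ⟨(hf.prodMap hf').isometryEquivOnRange.symm⟩

/-! ### Radial projection and nearest points of an equator -/

section Normalize

variable {E : Type*} [NormedAddCommGroup E] [NormedSpace ℝ E]

/-- Normalizing moves `w` by `|‖w‖ - 1|`, which is again at most `‖w - x‖`. -/
theorem norm_normalize_sub_le {x w : E} (hx : ‖x‖ = 1) : ‖‖w‖⁻¹ • w - x‖ ≤ 2 * ‖w - x‖ := by
  by_cases hw : w = 0
  · simp [hw, hx]
  have hn : ‖w‖ ≠ 0 := norm_ne_zero_iff.2 hw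
  have h1 : ‖‖w‖⁻¹ • w - w‖ = |‖w‖ - ‖x‖| := by
    rw [show ‖w‖⁻¹ • w - w = (‖w‖⁻¹ - 1) • w by module, norm_smul, Real.norm_eq_abs,
      ← abs_norm w, ← abs_mul, sub_mul, abs_norm, inv_mul_cancel₀ hn, hx, abs_sub_comm, one_mul]
  calc ‖‖w‖⁻¹ • w - x‖ = ‖(‖w‖⁻¹ • w - w) + (w - x)‖ := by congr 1; abel
    _ ≤ |‖w‖ - ‖x‖| + ‖w - x‖ := h1 ▸ norm_add_le _ _
    _ ≤ 2 * ‖w - x‖ := by linarith [abs_norm_sub_norm_le w x]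

theorem norm_normalize_sub_normalize_le {w z : E} (hz : z ≠ 0) :
    ‖‖w‖⁻¹ • w - ‖z‖⁻¹ • z‖ ≤ 2 * ‖z‖⁻¹ * ‖w - z‖ := by
  have hn : ‖z‖ ≠ 0 := norm_ne_zero_iff.2 hz
  have h := norm_normalize_sub_le (x := ‖z‖⁻¹ • z) (w := ‖z‖⁻¹ • w)
    (by rw [norm_smul, norm_inv, norm_norm, inv_mul_cancel₀ hn])
  rw [← smul_sub, norm_smul, norm_smul, norm_inv, norm_norm, smul_smul, mul_inv, inv_inv,
    mul_right_comm, mul_inv_cancel₀ hn, one_mul] at h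
  linarith

end Normalize

/-- The direction of a vector, and the last basis vector for the zero vector. -/
noncomputable def direction {m : ℕ} (w : Euc (m + 1)) : Sph m :=
  open Classical in
  if h : w = 0 then ⟨lastVec m, by simp [norm_lastVec]⟩
  else ⟨‖w‖⁻¹ • w, by
    rw [mem_sphere_zero_iff_norm, norm_smul, norm_inv, norm_norm,
      inv_mul_cancel₀ (norm_ne_zero_iff.2 h)]⟩

theorem direction_of_ne {m : ℕ} {w : Euc (m + 1)} (h : w ≠ 0) :
    (direction w : Euc (m + 1)) = ‖w‖⁻¹ • w := by
  rw [direction, dif_neg h]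

theorem measurable_direction (m : ℕ) : Measurable (direction (m := m)) := by
  refine measurable_of_continuousOn_compl_singleton 0 ?_
  refine continuousOn_iff_continuous_domRestrict.2 (Topology.IsInducing.subtypeVal.continuous_iff.2 ?_)
  have heq : Subtype.val ∘ ({0}ᶜ : Set (Euc (m + 1))).domRestrict direction =
      fun w : ({0}ᶜ : Set (Euc (m + 1))) => ‖(w : Euc (m + 1))‖⁻¹ • (w : Euc (m + 1)) := by
    funext w
    exact direction_of_ne w.2
  rw [heq]
  exact (continuous_subtype_val.norm.inv₀ fun w => norm_ne_zero_iff.2 w.2).smul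
    continuous_subtype_val

theorem norm_direction_sub_le {m : ℕ} {x w : Euc (m + 1)} (hx : ‖x‖ = 1) (hw : w ≠ 0) :
    ‖(direction w : Euc (m + 1)) - x‖ ≤ 2 * ‖w - x‖ := by
  rw [direction_of_ne hw]
  exact norm_normalize_sub_le hx

theorem ne_zero_of_norm_sub_lt {E : Type*} [NormedAddCommGroup E] {x w : E} (hx : ‖x‖ = 1)
    (h : ‖w - x‖ < 1) : w ≠ 0 := by
  rintro rfl
  rw [zero_sub, norm_neg, hx] at h
  exact lt_irrefl _ h

/-- The unit vector orthogonal to `v` closest to `x`. -/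
noncomputable def equatorProj {m : ℕ} (v x : Euc (m + 1)) : Sph m := direction (x - ⟪v, x⟫ • v)

section EquatorProj

variable {m : ℕ} {v x : Euc (m + 1)}

theorem norm_sub_inner_smul_sub (hv : ‖v‖ = 1) : ‖x - ⟪v, x⟫ • v - x‖ = |⟪v, x⟫| := by
  rw [sub_sub_cancel_left, norm_neg, norm_smul, hv, mul_one, Real.norm_eq_abs]

theorem norm_equatorProj_sub_le (hv : ‖v‖ = 1) (hx : ‖x‖ = 1) (h : |⟪v, x⟫| < 1) :
    ‖(equatorProj v x : Euc (m + 1)) - x‖ ≤ 2 * |⟪v, x⟫| := by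
  rw [← norm_sub_inner_smul_sub (x := x) hv] at h ⊢
  exact norm_direction_sub_le hx (ne_zero_of_norm_sub_lt hx h)

theorem inner_equatorProj (hv : ‖v‖ = 1) (hx : ‖x‖ = 1) (h : |⟪v, x⟫| < 1) :
    ⟪v, (equatorProj v x : Euc (m + 1))⟫ = 0 := by
  rw [← norm_sub_inner_smul_sub (x := x) hv] at h
  rw [equatorProj, direction_of_ne (ne_zero_of_norm_sub_lt hx h), real_inner_smul_right,
    inner_sub_right, real_inner_smul_right, real_inner_self_eq_norm_sq, hv]
  ring

/-- The projection stays in the plane of `v` and `x`. This keeps the second correction orthogonal to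
the first sphere point. -/
theorem inner_equatorProj_of_orthogonal {y : Euc (m + 1)} (hv : ‖v‖ = 1) (hx : ‖x‖ = 1)
    (h : |⟪v, x⟫| < 1) (hyv : ⟪y, v⟫ = 0) (hyx : ⟪y, x⟫ = 0) :
    ⟪y, (equatorProj v x : Euc (m + 1))⟫ = 0 := by
  rw [← norm_sub_inner_smul_sub (x := x) hv] at h
  rw [equatorProj, direction_of_ne (ne_zero_of_norm_sub_lt hx h), real_inner_smul_right,
    inner_sub_right, real_inner_smul_right, hyv, hyx]
  ring

end EquatorProj

/-! ### Small rotations given by products of two unit vectors -/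

/-- A product of two unit vectors acts as the product of the reflections in their lines. -/
theorem rot_rotor_apply {m : ℕ} [NeZero m] (u v : sphere (0 : Euc m) 1) (z : Euc m) :
    rot (rotor u v) z =
      (2 * ⟪(u : Euc m), (2 * ⟪(v : Euc m), z⟫) • (v : Euc m) - z⟫) • (u : Euc m) -
        ((2 * ⟪(v : Euc m), z⟫) • (v : Euc m) - z) := by
  have key : ∀ (u : sphere (0 : Euc m) 1) (z : Euc m),
      vec (u : Euc m) * vec z * vec (u : Euc m) =
        vec ((2 * ⟪(u : Euc m), z⟫) • (u : Euc m) - z) := by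
    intro u z
    have hu : ‖(u : Euc m)‖ = 1 := by simp
    rw [vec_mul_swap, sub_mul, mul_assoc, vec_mul_self_of_unit hu, mul_one, smul_mul_assoc,
      one_mul, map_sub, map_smul]
  refine vec_injective m ?_
  rw [vec_rot, coe_rotor_inv, ← key, ← key]
  change vec (u : Euc m) * vec (v : Euc m) * vec z * (vec (v : Euc m) * vec (u : Euc m)) = _
  noncomm_ring

/-- The midpoint of two unit vectors on the sphere. -/
noncomputable def midpointDir {m : ℕ} (x y : Euc (m + 1)) : Sph m := direction (x + y)

section Midpoint

variable {m : ℕ} {x y : Sph m}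

theorem add_ne_zero_of_norm_sub_lt (h : ‖(y : Euc (m + 1)) - x‖ < 1) :
    (x : Euc (m + 1)) + y ≠ 0 := by
  intro h0
  rw [eq_neg_of_add_eq_zero_right h0, show -(x : Euc (m + 1)) - x = (-2 : ℝ) • (x : Euc (m + 1)) by
    module, norm_smul] at h
  norm_num at h

/-- The chord midpoint is at half the distance, and normalizing at most doubles it. -/
theorem norm_midpointDir_sub_le (h : ‖(y : Euc (m + 1)) - x‖ < 1) :
    ‖(midpointDir (x : Euc (m + 1)) y : Euc (m + 1)) - x‖ ≤ ‖(y : Euc (m + 1)) - x‖ := by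
  have h0 := add_ne_zero_of_norm_sub_lt h
  have h1 := norm_normalize_sub_le (x := (x : Euc (m + 1)))
    (w := (1 / 2 : ℝ) • ((x : Euc (m + 1)) + y)) (by simp)
  have h2 : (1 / 2 : ℝ) • ((x : Euc (m + 1)) + y) - x = (1 / 2 : ℝ) • ((y : Euc (m + 1)) - x) := by
    module
  rw [h2, norm_smul, norm_smul, smul_smul, Real.norm_of_nonneg one_half_pos.le, mul_inv,
    mul_right_comm, inv_mul_cancel₀ one_half_pos.ne', one_mul, ← mul_assoc,
    mul_one_div_cancel two_ne_zero, one_mul] at h1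
  rwa [midpointDir, direction_of_ne h0]

/-- The reflection in the line of `x` fixes `x`, and the reflection in the line of the midpoint
exchanges `x` and `y`. -/
theorem rot_rotor_midpointDir (h : ‖(y : Euc (m + 1)) - x‖ < 1) :
    rot (rotor (midpointDir (x : Euc (m + 1)) y) x) (x : Euc (m + 1)) = y := by
  have h0 := add_ne_zero_of_norm_sub_lt h
  rw [rot_rotor, midpointDir, direction_of_ne h0]
  set w := (x : Euc (m + 1)) + y with hw
  have hwn : ‖w‖ ≠ 0 := norm_ne_zero_iff.2 h0
  have hx1 : ‖(x : Euc (m + 1))‖ = 1 := by simp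
  have hy1 : ‖(y : Euc (m + 1))‖ = 1 := by simp
  have h2 : 2 * ⟪w, (x : Euc (m + 1))⟫ = ‖w‖ ^ 2 := by
    rw [← real_inner_self_eq_norm_sq, hw]
    simp only [inner_add_left, inner_add_right, real_inner_self_eq_norm_sq, hx1, hy1,
      real_inner_comm (x : Euc (m + 1)) (y : Euc (m + 1))]
    ring
  rw [real_inner_smul_left, mul_left_comm, h2, smul_smul,
    show ‖w‖⁻¹ * ‖w‖ ^ 2 * ‖w‖⁻¹ = 1 by field_simp, one_smul, hw, add_sub_cancel_left]

/-- Both reflections act as `-1` on the orthogonal of the plane of `x` and `y`. -/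
theorem rot_rotor_midpointDir_of_orthogonal (h : ‖(y : Euc (m + 1)) - x‖ < 1)
    {z : Euc (m + 1)} (hx : ⟪z, (x : Euc (m + 1))⟫ = 0) (hy : ⟪z, (y : Euc (m + 1))⟫ = 0) :
    rot (rotor (midpointDir (x : Euc (m + 1)) y) x) z = z := by
  have h1 : ⟪(midpointDir (x : Euc (m + 1)) y : Euc (m + 1)), z⟫ = 0 := by
    rw [midpointDir, direction_of_ne (add_ne_zero_of_norm_sub_lt h), real_inner_smul_left,
      inner_add_left, real_inner_comm, hx, real_inner_comm, hy]
    ring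
  rw [rot_rotor_apply, real_inner_comm z, hx]
  simp [h1]

end Midpoint

/-! ### Lengths of curves, with constants independent of the dimension -/

section Frame

variable {m : ℕ}

theorem norm_frame_sub_sq (g h : Spin m) :
    ‖frame g - frame h‖ ^ 2 =
      1 / 2 * ∑ i, ‖rot g (EuclideanSpace.single i 1) - rot h (EuclideanSpace.single i 1)‖ ^ 2 := by
  rw [PiLp.norm_sq_eq_of_L2, Finset.mul_sum]
  refine Finset.sum_congr rfl fun i _ => ?_
  change ‖(√2)⁻¹ • rot g (EuclideanSpace.single i 1) -
    (√2)⁻¹ • rot h (EuclideanSpace.single i 1)‖ ^ 2 = _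
  rw [← smul_sub, norm_smul, mul_pow, norm_inv, inv_pow, Real.norm_eq_abs, sq_abs,
    Real.sq_sqrt zero_le_two, one_div]

theorem dist_frame_mul_left (k g h : Spin m) :
    dist (frame (k * g)) (frame (k * h)) = dist (frame g) (frame h) := by
  rw [dist_eq_norm, dist_eq_norm, ← pow_left_inj₀ (norm_nonneg _) (norm_nonneg _) two_ne_zero,
    norm_frame_sub_sq, norm_frame_sub_sq]
  simp only [rot_mul_apply, ← map_sub, LinearIsometryEquiv.norm_map]

theorem orthonormal_rot_single (g : Spin m) :
    Orthonormal ℝ fun i : Fin m => rot g (EuclideanSpace.single i 1) :=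
  (EuclideanSpace.orthonormal_single).comp_linearIsometryEquiv (rot g)

theorem rotor_mul_rotor [NeZero m] (u v w : sphere (0 : Euc m) 1) :
    rotor u v * rotor v w = rotor u w := by
  refine Subtype.ext ?_
  change vec (u : Euc m) * vec (v : Euc m) * (vec (v : Euc m) * vec (w : Euc m)) =
    vec (u : Euc m) * vec (w : Euc m)
  rw [mul_assoc, ← mul_assoc (vec (v : Euc m)), vec_mul_self_of_unit (by simp), one_mul]

theorem rotor_self [NeZero m] (u : sphere (0 : Euc m) 1) : rotor u u = 1 :=
  Subtype.ext (vec_mul_self_of_unit (by simp))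

theorem norm_rot_rotor_sub_sq_le [NeZero m] (u v : sphere (0 : Euc m) 1) (z : Euc m) :
    ‖rot (rotor u v) z - z‖ ^ 2 ≤
      8 * (⟪z, (2 * ⟪(v : Euc m), (u : Euc m) - v⟫) • (v : Euc m) - ((u : Euc m) - v)⟫ ^ 2 +
        ⟪z, (v : Euc m)⟫ ^ 2 * ‖(u : Euc m) - v‖ ^ 2) := by
  have hu : ‖(u : Euc m)‖ = 1 := by simp
  have hvv : ⟪(v : Euc m), (v : Euc m)⟫ = 1 := by rw [real_inner_self_eq_norm_sq]; simp
  set c := (2 * ⟪(v : Euc m), (u : Euc m) - v⟫) • (v : Euc m) - ((u : Euc m) - v) with hc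
  -- With `R_u`, `R_v` the reflections in the lines, `z = R_v (R_v z)`, so the difference is `R_u -
  -- R_v` applied to `R_v z`. The vector `c` is `R_v (u - v)`.
  have h1 : rot (rotor u v) z - z =
      (2 : ℝ) • (⟪z, c⟫ • (u : Euc m) + ⟪z, (v : Euc m)⟫ • ((u : Euc m) - v)) := by
    rw [rot_rotor_apply, hc]
    simp only [inner_sub_right, real_inner_smul_right, hvv, real_inner_comm (u : Euc m) z,
      real_inner_comm (v : Euc m) z, real_inner_comm (v : Euc m) (u : Euc m)]
    module
  have h2 : ‖⟪z, c⟫ • (u : Euc m) + ⟪z, (v : Euc m)⟫ • ((u : Euc m) - v)‖ ≤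
      |⟪z, c⟫| + |⟪z, (v : Euc m)⟫| * ‖(u : Euc m) - v‖ := by
    refine (norm_add_le _ _).trans_eq ?_
    rw [norm_smul, norm_smul, hu, mul_one, Real.norm_eq_abs, Real.norm_eq_abs]
  rw [h1, norm_smul, mul_pow]
  have h3 := pow_le_pow_left₀ (norm_nonneg _) h2 2
  have h4 := sq_nonneg (|⟪z, c⟫| - |⟪z, (v : Euc m)⟫| * ‖(u : Euc m) - v‖)
  rw [← sq_abs ⟪z, c⟫, ← sq_abs ⟪z, (v : Euc m)⟫, Real.norm_two]
  nlinarith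

/-- The displacement of a vector `z` is controlled by its inner products with the two vectors `c`
and `v` alone. Summing over the orthonormal columns of `g`, Bessel replaces a factor `m` by a
constant. -/
theorem dist_frame_rotor_mul_le [NeZero m] (u v : sphere (0 : Euc m) 1) (g : Spin m) :
    dist (frame (rotor u v * g)) (frame g) ≤ 4 * dist u v := by
  have hv : ‖(v : Euc m)‖ = 1 := by simp
  set c := (2 * ⟪(v : Euc m), (u : Euc m) - v⟫) • (v : Euc m) - ((u : Euc m) - v) with hc
  have hcn : ‖c‖ ^ 2 = ‖(u : Euc m) - v‖ ^ 2 := by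
    rw [hc, norm_sub_sq_real, norm_smul, mul_pow, hv, Real.norm_eq_abs, sq_abs,
      real_inner_smul_left]
    ring
  have hb := orthonormal_rot_single g
  have hbessel : ∀ w : Euc m, ∑ i, ⟪rot g (EuclideanSpace.single i 1), w⟫ ^ 2 ≤ ‖w‖ ^ 2 := by
    intro w
    simpa only [Real.norm_eq_abs, sq_abs] using hb.sum_inner_products_le w (s := Finset.univ)
  rw [Subtype.dist_eq, dist_eq_norm, dist_eq_norm]
  refine abs_le_of_sq_le_sq' ?_ (by positivity) |>.2
  rw [norm_frame_sub_sq]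
  have hsum : ∑ i, ‖rot (rotor u v * g) (EuclideanSpace.single i 1) -
      rot g (EuclideanSpace.single i 1)‖ ^ 2 ≤
      8 * (‖c‖ ^ 2 + ‖(v : Euc m)‖ ^ 2 * ‖(u : Euc m) - v‖ ^ 2) := by
    refine (Finset.sum_le_sum fun i _ => ?_).trans
      (?_ : ∑ i, 8 * (⟪rot g (EuclideanSpace.single i 1), c⟫ ^ 2 +
        ⟪rot g (EuclideanSpace.single i 1), (v : Euc m)⟫ ^ 2 * ‖(u : Euc m) - v‖ ^ 2) ≤ _)
    · rw [rot_mul_apply]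
      exact norm_rot_rotor_sub_sq_le u v _
    · rw [← Finset.mul_sum, Finset.sum_add_distrib, ← Finset.sum_mul]
      gcongr
      · exact hbessel c
      · exact hbessel v
  rw [hcn, hv] at hsum
  nlinarith [sq_nonneg ‖(u : Euc m) - v‖]

theorem continuous_rotor [NeZero m] :
    Continuous fun z : sphere (0 : Euc m) 1 × sphere (0 : Euc m) 1 => rotor z.1 z.2 :=
  Continuous.subtype_mk (((continuous_vec m).comp (continuous_subtype_val.comp continuous_fst)).mul
    ((continuous_vec m).comp (continuous_subtype_val.comp continuous_snd))) _

theorem spinEDist_le_of_lipschitz {g h : Spin m} (γ : Path g h) {C : ℝ}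
    (hC : ∀ s t, dist (frame (γ s)) (frame (γ t)) ≤ C * dist s t) :
    spinEDist g h ≤ ENNReal.ofReal C := by
  have hL : LipschitzOnWith C.toNNReal (fun t => frame (γ t)) univ :=
    LipschitzOnWith.of_dist_le_mul fun s _ t _ => (hC s t).trans
      (mul_le_mul_of_nonneg_right (Real.le_coe_toNNReal C) dist_nonneg)
  -- The unit interval has length one.
  have h1 : eVariationOn (fun t : unitInterval => t) univ ≤ 1 := by
    have h2 := (show Monotone fun t : unitInterval => (t : ℝ) from fun _ _ hst => hst).monotoneOn
      univ |>.eVariationOn_eq (mem_univ 0) (mem_univ 1)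
    have h3 : (univ ∩ Icc 0 1 : Set unitInterval) = univ := by
      rw [univ_inter]
      exact eq_univ_of_forall fun t => t.2
    rw [h3, Set.Icc.coe_one, Set.Icc.coe_zero, sub_zero, ENNReal.ofReal_one] at h2
    exact h2.le
  calc spinEDist g h ≤ eVariationOn (fun t => frame (γ t)) univ := iInf_le _ γ
    _ ≤ C.toNNReal * eVariationOn (fun t : unitInterval => t) univ :=
      hL.comp_eVariationOn_le (mapsTo_univ _ _)
    _ ≤ C.toNNReal * 1 := by gcongr
    _ = ENNReal.ofReal C := mul_one _

end Frame

section Arc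

variable {m : ℕ}

/-- A parametrization of the short arc from `x` to `u` on the sphere. -/
noncomputable def arc (x u : Sph m) (t : unitInterval) : Sph m :=
  direction ((x : Euc (m + 1)) + (t : ℝ) • ((u : Euc (m + 1)) - x))

theorem direction_coe (x : Sph m) : direction (x : Euc (m + 1)) = x := by
  have hx : ‖(x : Euc (m + 1))‖ = 1 := by simp
  refine Subtype.ext ?_
  rw [direction_of_ne (norm_ne_zero_iff.1 (by rw [hx]; exact one_ne_zero)), hx, inv_one, one_smul]

theorem arc_zero (x u : Sph m) : arc x u 0 = x := by simp [arc, direction_coe]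

theorem arc_one (x u : Sph m) : arc x u 1 = u := by simp [arc, direction_coe]

/-- The chord stays at norm at least `1/2`, where radial projection is Lipschitz with constant `2 *
(1/2)⁻¹ = 4`. -/
theorem dist_arc_le {x u : Sph m} (h : ‖(u : Euc (m + 1)) - x‖ ≤ 1 / 2) (s t : unitInterval) :
    dist (arc x u s) (arc x u t) ≤ 4 * ‖(u : Euc (m + 1)) - x‖ * dist s t := by
  have hx : ‖(x : Euc (m + 1))‖ = 1 := by simp
  have hn : ∀ t : unitInterval, 1 / 2 ≤ ‖(x : Euc (m + 1)) + (t : ℝ) • ((u : Euc (m + 1)) - x)‖ := by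
    intro t
    have h1 := norm_sub_le_norm_add (x : Euc (m + 1)) ((t : ℝ) • ((u : Euc (m + 1)) - x))
    rw [norm_smul, hx, Real.norm_of_nonneg t.2.1] at h1
    nlinarith [t.2.1, t.2.2, norm_nonneg ((u : Euc (m + 1)) - x)]
  have h0 : ∀ t : unitInterval, (x : Euc (m + 1)) + (t : ℝ) • ((u : Euc (m + 1)) - x) ≠ 0 :=
    fun t => norm_pos_iff.1 (one_half_pos.trans_le (hn t))
  rw [Subtype.dist_eq, Subtype.dist_eq, dist_eq_norm, arc, arc, direction_of_ne (h0 s),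
    direction_of_ne (h0 t)]
  refine (norm_normalize_sub_normalize_le (h0 t)).trans ?_
  have h2 : (x : Euc (m + 1)) + (s : ℝ) • ((u : Euc (m + 1)) - x) -
      (x + (t : ℝ) • ((u : Euc (m + 1)) - x)) = ((s : ℝ) - t) • ((u : Euc (m + 1)) - x) := by module
  rw [h2, norm_smul, ← dist_eq_norm]
  have h3 := inv_anti₀ one_half_pos (hn t)
  calc _ ≤ 2 * (1 / 2)⁻¹ * (dist (s : ℝ) t * ‖(u : Euc (m + 1)) - x‖) := by gcongr
    _ = _ := by ring

theorem continuous_arc {x u : Sph m} (h : ‖(u : Euc (m + 1)) - x‖ ≤ 1 / 2) :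
    Continuous (arc x u) :=
  (LipschitzWith.of_dist_le_mul (K := ⟨4 * ‖(u : Euc (m + 1)) - x‖, by positivity⟩)
    (dist_arc_le h)).continuous

/-- Both rotors grow from `1` simultaneously along short arcs, which gives a path in the spin group
itself. The constant is `16 = 4 * 4`: the Lipschitz constants of the rotor in its first vector and
of the arc. -/
theorem spinEDist_rotor_mul_rotor_mul_le {x u y v : Sph m} (g : Spin (m + 1))
    (hu : ‖(u : Euc (m + 1)) - x‖ ≤ 1 / 2) (hv : ‖(v : Euc (m + 1)) - y‖ ≤ 1 / 2) :
    spinEDist g (rotor v y * (rotor u x * g)) ≤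
      ENNReal.ofReal (16 * (‖(u : Euc (m + 1)) - x‖ + ‖(v : Euc (m + 1)) - y‖)) := by
  have hc : ∀ {x u : Sph m}, ‖(u : Euc (m + 1)) - x‖ ≤ 1 / 2 →
      Continuous fun t => rotor (arc x u t) x := fun h =>
    continuous_rotor.comp ((continuous_arc h).prodMk continuous_const)
  have hmul : ∀ (u u' x : Sph m) (k : Spin (m + 1)),
      dist (frame (rotor u x * k)) (frame (rotor u' x * k)) ≤ 4 * dist u u' := by
    intro u u' x k
    -- Two rotors with the same second vector differ by left multiplication by the rotor of `u` and
    -- `u'`.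
    rw [← rotor_mul_rotor u u' x, mul_assoc]
    exact dist_frame_rotor_mul_le u u' _
  let γ : Path g (rotor v y * (rotor u x * g)) :=
    { toFun := fun t => rotor (arc y v t) y * (rotor (arc x u t) x * g)
      continuous_toFun := (hc hv).mul ((hc hu).mul continuous_const)
      source' := by simp only [arc_zero, rotor_self, one_mul]
      target' := by simp only [arc_one] }
  refine spinEDist_le_of_lipschitz γ fun s t => ?_
  change dist (frame (rotor (arc y v s) y * (rotor (arc x u s) x * g)))
    (frame (rotor (arc y v t) y * (rotor (arc x u t) x * g))) ≤ _
  refine (dist_triangle _ (frame (rotor (arc y v s) y * (rotor (arc x u t) x * g))) _).trans ?_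
  rw [dist_frame_mul_left]
  have h1 := hmul (arc x u s) (arc x u t) x g
  have h2 := hmul (arc y v s) (arc y v t) y (rotor (arc x u t) x * g)
  have h3 := dist_arc_le hu s t
  have h4 := dist_arc_le hv s t
  linarith

end Arc

/-! ### Invariance of the Haar measure and second moments -/

instance instIsHaarMeasureHaarProb (m : ℕ) [NeZero m] : (haarProb m).IsHaarMeasure :=
  inferInstanceAs (Measure.haarMeasure ⊤).IsHaarMeasure

instance instIsMulRightInvariantHaarProb (m : ℕ) [NeZero m] :
    (haarProb m).IsMulRightInvariant where
  map_mul_right_eq_self g := by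
    have : IsProbabilityMeasure ((haarProb m).map (· * g)) :=
      Measure.isProbabilityMeasure_map (continuous_mul_const g).measurable.aemeasurable
    exact Measure.isHaarMeasure_eq_of_isProbabilityMeasure _ _

/-- Chebyshev's inequality for the second moment. Right translation by `h` keeps `F` and carries `v`
to `b i`, so all `⟪F g, g (b i)⟫ ^ 2` have the same mean; their sum is at most `1` by Bessel. -/
theorem haarProb_le_abs_inner_rot_le {m : ℕ} [NeZero m] {ι : Type*} [Fintype ι] [Nonempty ι]
    {F : Spin m → Euc m} (hF : Measurable F) (hF1 : ∀ g, ‖F g‖ ≤ 1) {v : Euc m} {b : ι → Euc m}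
    (hb : Orthonormal ℝ b) (hFb : ∀ i, ∃ h : Spin m, rot h v = b i ∧ ∀ g, F (g * h) = F g)
    {δ : ℝ} (hδ : 0 < δ) :
    haarProb m {g | δ ≤ |⟪F g, rot g v⟫|} ≤ ENNReal.ofReal (Fintype.card ι * δ ^ 2)⁻¹ := by
  have hmeas : ∀ u : Euc m, Measurable fun g : Spin m => ENNReal.ofReal (⟪F g, rot g u⟫ ^ 2) :=
    fun u => ((hF.inner (continuous_rot_apply u).measurable).pow_const 2).ennreal_ofReal
  have hint : ∀ i, ∫⁻ g, ENNReal.ofReal (⟪F g, rot g (b i)⟫ ^ 2) ∂haarProb m =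
      ∫⁻ g, ENNReal.ofReal (⟪F g, rot g v⟫ ^ 2) ∂haarProb m := by
    intro i
    obtain ⟨h, hh, hFh⟩ := hFb i
    rw [← lintegral_mul_right_eq_self (fun g => ENNReal.ofReal (⟪F g, rot g v⟫ ^ 2)) h]
    simp only [hFh, rot_mul_apply, hh]
  have hsum : (Fintype.card ι : ℝ≥0∞) *
      ∫⁻ g, ENNReal.ofReal (⟪F g, rot g v⟫ ^ 2) ∂haarProb m ≤ 1 := by
    calc _ = ∑ i, ∫⁻ g, ENNReal.ofReal (⟪F g, rot g (b i)⟫ ^ 2) ∂haarProb m := by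
          simp [hint]
      _ = ∫⁻ g, ∑ i, ENNReal.ofReal (⟪F g, rot g (b i)⟫ ^ 2) ∂haarProb m :=
          (lintegral_finsetSum _ fun i _ => hmeas (b i)).symm
      _ ≤ ∫⁻ _, 1 ∂haarProb m := by
          refine lintegral_mono fun g => ?_
          rw [← ENNReal.ofReal_sum_of_nonneg fun _ _ => sq_nonneg _, ENNReal.ofReal_le_one]
          have := (hb.comp_linearIsometryEquiv (rot g)).sum_inner_products_le (F g)
            (s := Finset.univ)
          simp only [Real.norm_eq_abs, sq_abs, Function.comp_apply] at this
          simp only [real_inner_comm (F g)] at this ⊢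
          exact this.trans (pow_le_one₀ (norm_nonneg _) (hF1 g))
      _ = 1 := by simp
  have hmarkov := mul_meas_ge_le_lintegral (μ := haarProb m) (hmeas v) (ENNReal.ofReal (δ ^ 2))
  have hset : {g : Spin m | δ ≤ |⟪F g, rot g v⟫|} ⊆
      {g | ENNReal.ofReal (δ ^ 2) ≤ ENNReal.ofReal (⟪F g, rot g v⟫ ^ 2)} := by
    intro g hg
    refine ENNReal.ofReal_le_ofReal ?_
    rw [← sq_abs ⟪F g, rot g v⟫]
    exact pow_le_pow_left₀ hδ.le hg 2
  have hcard : (0 : ℝ) < Fintype.card ι := Nat.cast_pos.2 Fintype.card_pos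
  rw [ENNReal.ofReal_inv_of_pos (by positivity), ENNReal.le_inv_iff_mul_le,
    ENNReal.ofReal_mul hcard.le, ENNReal.ofReal_natCast, mul_comm, mul_assoc]
  refine le_trans ?_ hsum
  gcongr
  exact (mul_le_mul_right (measure_mono hset) _).trans hmarkov

theorem baseCoord_mul_spinIncl (g : Spin (d + 2)) (h : Spin (d + 1)) :
    baseCoord (g * spinIncl (d + 1) h) = baseCoord g :=
  Subtype.ext (by
    change rot _ _ = rot _ _
    rw [rot_mul_apply, rot_spinIncl_lastVec])

/-- With high probability, `g e` is almost orthogonal to a given vector and `g e'` to a given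
vector that depends on `g e`. -/
theorem one_sub_le_haarProb {p : Euc (d + 3)} (hp : ‖p‖ ≤ 1) {w : Sph (d + 2) → Euc (d + 3)}
    (hw : Measurable w) (hw1 : ∀ x, ‖w x‖ ≤ 1) {δ : ℝ} (hδ : 0 < δ) {A : Set (Spin (d + 3))}
    (hA : ∀ g : Spin (d + 3), |⟪p, rot g (lastVec (d + 2))⟫| < δ →
      |⟪w (baseCoord g), rot g (incl (d + 2) (lastVec (d + 1)))⟫| < δ → g ∈ A) :
    1 - 2 * ENNReal.ofReal ((d + 2) * δ ^ 2)⁻¹ ≤ haarProb (d + 3) A := by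
  have h1 := haarProb_le_abs_inner_rot_le (F := fun _ => p) measurable_const (fun _ => hp)
    (v := lastVec (d + 2)) (EuclideanSpace.orthonormal_single (ι := Fin (d + 3)) (𝕜 := ℝ))
    (fun i => (exists_rot_eq (norm_lastVec (d + 2)) (by simp)).imp
      fun h hh => ⟨hh, fun _ => rfl⟩) hδ
  -- Only translations by the stabilizer of `e` preserve `baseCoord`, hence one basis vector fewer:
  -- the `d + 2` vectors orthogonal to `e`.
  have h2 := haarProb_le_abs_inner_rot_le (F := fun g => w (baseCoord g))
    (hw.comp continuous_baseCoord.measurable) (fun _ => hw1 _)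
    (v := incl (d + 2) (lastVec (d + 1)))
    ((EuclideanSpace.orthonormal_single (ι := Fin (d + 2)) (𝕜 := ℝ)).comp_linearIsometry
      (incl (d + 2)))
    (fun i => by
      obtain ⟨h, hh⟩ := exists_rot_eq (norm_lastVec (d + 1))
        (w := EuclideanSpace.single i (1 : ℝ)) (by simp)
      refine ⟨spinIncl (d + 2) h, ?_, fun g => by rw [baseCoord_mul_spinIncl]⟩
      rw [rot_spinIncl_incl, hh, Function.comp_apply]) hδ
  rw [Fintype.card_fin] at h1 h2
  have h3 : ENNReal.ofReal (((d + 3 : ℕ) : ℝ) * δ ^ 2)⁻¹ ≤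
      ENNReal.ofReal ((d + 2) * δ ^ 2)⁻¹ := by
    refine ENNReal.ofReal_le_ofReal (inv_anti₀ (by positivity) ?_)
    push_cast
    nlinarith [sq_nonneg δ]
  -- Subadditivity on a cover of the group, instead of passing to complements, requires no
  -- measurability of `A`.
  have hcov : (univ : Set (Spin (d + 3))) ⊆ A ∪ ({g | δ ≤ |⟪p, rot g (lastVec (d + 2))⟫|} ∪
      {g | δ ≤ |⟪w (baseCoord g), rot g (incl (d + 2) (lastVec (d + 1)))⟫|}) := by
    intro g _
    by_cases hg : δ ≤ |⟪p, rot g (lastVec (d + 2))⟫|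
    · exact Or.inr (Or.inl hg)
    by_cases hg' : δ ≤ |⟪w (baseCoord g), rot g (incl (d + 2) (lastVec (d + 1)))⟫|
    · exact Or.inr (Or.inr hg')
    exact Or.inl (hA g (not_le.1 hg) (not_le.1 hg'))
  rw [tsub_le_iff_right, ← measure_univ (μ := haarProb (d + 3))]
  refine (measure_mono hcov).trans ((measure_union_le _ _).trans ?_)
  gcongr
  refine (measure_union_le _ _).trans ?_
  rw [two_mul]
  push_cast at h2
  exact add_le_add (h1.trans h3) h2

theorem tendsto_haarProb_one {p : ∀ k : ℕ, Sph (2 * k + 2)} {w : ∀ k, Sph (2 * k + 2) → Euc (2 * k + 3)}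
    (hw : ∀ k, Measurable (w k)) (hw1 : ∀ k x, ‖w k x‖ ≤ 1) {δ : ℝ} (hδ : 0 < δ)
    {A : ∀ k, Set (Spin (2 * k + 3))}
    (hA : ∀ k (g : Spin (2 * k + 3)), |⟪(p k : Euc (2 * k + 3)), rot g (lastVec (2 * k + 2))⟫| < δ →
      |⟪w k (baseCoord g), rot g (incl (2 * k + 2) (lastVec (2 * k + 1)))⟫| < δ → g ∈ A k) :
    Tendsto (fun k => haarProb (2 * k + 3) (A k)) atTop (𝓝 1) := by
  have h1 : Tendsto (fun k : ℕ => (((2 * k : ℕ) + 2 : ℝ) * δ ^ 2)⁻¹) atTop (𝓝 0) := by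
    refine Tendsto.inv_tendsto_atTop (Tendsto.atTop_mul_const (by positivity)
      (tendsto_atTop_add_const_right _ _ (tendsto_natCast_atTop_atTop.comp
        (tendsto_id.const_mul_atTop' two_pos))))
  have h2 : Tendsto (fun k : ℕ => 1 - 2 * ENNReal.ofReal (((2 * k : ℕ) + 2 : ℝ) * δ ^ 2)⁻¹) atTop
      (𝓝 1) := by
    have h3 := ENNReal.Tendsto.const_mul (ENNReal.tendsto_ofReal h1) (a := 2)
      (Or.inr ENNReal.ofNat_ne_top)
    simpa using ENNReal.Tendsto.sub tendsto_const_nhds h3 (Or.inl ENNReal.one_ne_top)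
  exact tendsto_of_tendsto_of_tendsto_of_le_of_le h2 tendsto_const_nhds
    (fun k => one_sub_le_haarProb (by simp) (hw k) (hw1 k) hδ (hA k)) fun k => prob_le_one

/-! ### Approach to the bi-equator and to its preimage -/

theorem measurable_rot_section (s : SphereSection (d + 1)) (v : Euc (d + 2)) :
    Measurable fun x => rot (s.toFun x) v :=
  (continuous_rot_apply v).measurable.comp s.measurable_toFun

/-- This turns the height of `y` over its equator into the inner product of `g e'` with a vector
depending on `g e` only, the form that the second moment bound requires. -/
theorem inner_fibreCoord (s : SphereSection (d + 1)) (q : Sph d) (g : Spin (d + 2)) :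
    ⟪(q : Euc (d + 1)), (fibreCoord s g : Euc (d + 1))⟫ =
      ⟪rot (s.toFun (baseCoord g)) (incl (d + 1) q), rot g (incl (d + 1) (lastVec d))⟫ := by
  rw [← rot_section_fibreCoord s g, LinearIsometryEquiv.inner_map_map,
    LinearIsometry.inner_map_map]

theorem mem_thickening_biEquator {p : Sph (d + 1)} {q : Sph d} {b : Sph (d + 1) × Sph d} {δ : ℝ}
    (hδ : δ ≤ 1) (h1 : |⟪(p : Euc (d + 2)), (b.1 : Euc (d + 2))⟫| < δ)
    (h2 : |⟪(q : Euc (d + 1)), (b.2 : Euc (d + 1))⟫| < δ) :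
    b ∈ thickening (2 * δ) (biEquator p q) := by
  refine mem_thickening_iff.2 ⟨(equatorProj (p : Euc (d + 2)) b.1, equatorProj (q : Euc (d + 1)) b.2),
    ⟨inner_equatorProj (by simp) (by simp) (h1.trans_le hδ),
      inner_equatorProj (by simp) (by simp) (h2.trans_le hδ)⟩, ?_⟩
  rw [dist_comm, Prod.dist_eq, max_lt_iff, Subtype.dist_eq, Subtype.dist_eq, dist_eq_norm,
    dist_eq_norm]
  have h3 := norm_equatorProj_sub_le (v := (p : Euc (d + 2))) (x := b.1) (by simp) (by simp)
    (h1.trans_le hδ)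
  have h4 := norm_equatorProj_sub_le (v := (q : Euc (d + 1))) (x := b.2) (by simp) (by simp)
    (h2.trans_le hδ)
  exact ⟨by linarith, by linarith⟩

/-- The image of `q` by the section at the point `x'` of the equator closest to `x`, carried back
to the orthogonal of `x` by the rotation that sends `x` to `x'`. -/
noncomputable def carriedPole (s : SphereSection (d + 1)) (p : Sph (d + 1)) (q : Sph d)
    (x : Sph (d + 1)) : Euc (d + 2) :=
  rot (rotor (midpointDir (x : Euc (d + 2)) (equatorProj (p : Euc (d + 2)) x)) x)⁻¹
    (rot (s.toFun (equatorProj (p : Euc (d + 2)) x)) (incl (d + 1) q))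

theorem norm_carriedPole (s : SphereSection (d + 1)) (p : Sph (d + 1)) (q : Sph d)
    (x : Sph (d + 1)) : ‖carriedPole s p q x‖ = 1 := by
  rw [carriedPole, LinearIsometryEquiv.norm_map, LinearIsometryEquiv.norm_map,
    LinearIsometry.norm_map]
  simp

theorem measurable_carriedPole (s : SphereSection (d + 1)) (p : Sph (d + 1)) (q : Sph d) :
    Measurable (carriedPole s p q) := by
  have hproj : Measurable fun x : Sph (d + 1) => equatorProj (p : Euc (d + 2)) (x : Euc (d + 2)) := by
    refine (measurable_direction _).comp (Continuous.measurable ?_)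
    fun_prop
  have hmid : Measurable fun x : Sph (d + 1) =>
      midpointDir (x : Euc (d + 2)) (equatorProj (p : Euc (d + 2)) (x : Euc (d + 2))) :=
    (measurable_direction _).comp (measurable_subtype_coe.add (measurable_subtype_coe.comp hproj))
  have hcont : Continuous fun z : (Sph (d + 1) × Sph (d + 1)) × Euc (d + 2) =>
      rot (rotor z.1.1 z.1.2)⁻¹ z.2 := by
    have hinv : Continuous fun z : (Sph (d + 1) × Sph (d + 1)) × Euc (d + 2) =>
        (rotor z.1.1 z.1.2)⁻¹ := (continuous_rotor.comp continuous_fst).inv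
    exact (continuous_rot (d + 2)).comp (f := fun z : (Sph (d + 1) × Sph (d + 1)) × Euc (d + 2) =>
      ((rotor z.1.1 z.1.2)⁻¹, z.2)) (hinv.prodMk continuous_snd)
  have hpole : Measurable fun x : Sph (d + 1) =>
      rot (s.toFun (equatorProj (p : Euc (d + 2)) (x : Euc (d + 2)))) (incl (d + 1) q) :=
    (measurable_rot_section s _).comp hproj
  exact hcont.measurable.comp (f := fun x : Sph (d + 1) =>
      ((midpointDir (x : Euc (d + 2)) (equatorProj (p : Euc (d + 2)) (x : Euc (d + 2))), x),
        rot (s.toFun (equatorProj (p : Euc (d + 2)) (x : Euc (d + 2)))) (incl (d + 1) q)))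
    ((hmid.prodMk measurable_id).prodMk hpole)

/-- The rotation `k` brings `g e` to the equator. The carried pole is chosen so that `k g e'` is
then almost orthogonal to `s(x') q`, with `s` already evaluated at the new point `x'`. A second
rotation `l` corrects the remaining error and fixes `x'`, so `s` is not evaluated anywhere else and
its continuity plays no role. -/
theorem exists_mem_biEquatorLocus_spinEDist_le (s : SphereSection (d + 1)) (p : Sph (d + 1))
    (q : Sph d) (g : Spin (d + 2)) {δ : ℝ} (hδ : δ ≤ 1 / 4)
    (h1 : |⟪(p : Euc (d + 2)), rot g (lastVec (d + 1))⟫| < δ)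
    (h2 : |⟪carriedPole s p q (baseCoord g), rot g (incl (d + 1) (lastVec d))⟫| < δ) :
    ∃ a ∈ biEquatorLocus s p q, spinEDist g a ≤ ENNReal.ofReal (64 * δ) := by
  set x := baseCoord g with hx
  set x' := equatorProj (p : Euc (d + 2)) x with hx'
  set k := rotor (midpointDir (x : Euc (d + 2)) x') x with hk
  set v := rot (s.toFun x') (incl (d + 1) q) with hv
  have hv1 : ‖v‖ = 1 := by
    rw [hv, LinearIsometryEquiv.norm_map, LinearIsometry.norm_map]
    simp
  have h1' : |⟪(p : Euc (d + 2)), (x : Euc (d + 2))⟫| < 1 := by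
    refine lt_trans (b := δ) h1 ?_
    linarith
  have hxx : ‖(x' : Euc (d + 2)) - x‖ ≤ 2 * δ :=
    (norm_equatorProj_sub_le (by simp) (by simp) h1').trans (by
      linarith [show |⟪(p : Euc (d + 2)), (x : Euc (d + 2))⟫| < δ from h1])
  have hxx' : ‖(x' : Euc (d + 2)) - x‖ < 1 := by linarith
  have hkx : rot (k * g) (lastVec (d + 1)) = x' := by
    rw [rot_mul_apply]
    exact rot_rotor_midpointDir hxx'
  let z : Sph (d + 1) := ⟨rot (k * g) (incl (d + 1) (lastVec d)), by simp [norm_lastVec]⟩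
  -- Moving `k` across the inner product turns the carried pole back into `v`.
  have h2' : |⟪v, (z : Euc (d + 2))⟫| < δ := by
    refine lt_of_eq_of_lt ?_ h2
    change |⟪v, rot (k * g) _⟫| = |⟪rot k⁻¹ v, _⟫|
    rw [inner_rot_inv, rot_mul_apply]
  have h2'' : |⟪v, (z : Euc (d + 2))⟫| < 1 := by linarith
  set z' := equatorProj v z with hz'
  have hzz : ‖(z' : Euc (d + 2)) - z‖ ≤ 2 * δ :=
    (norm_equatorProj_sub_le hv1 (by simp) h2'').trans (by linarith)
  have hzz' : ‖(z' : Euc (d + 2)) - z‖ < 1 := by linarith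
  have hxz : ⟪(x' : Euc (d + 2)), (z : Euc (d + 2))⟫ = 0 := by
    rw [← hkx]
    exact ((rot (k * g)).inner_map_map _ _).trans (inner_lastVec_incl _)
  -- Both vectors are images under `s(x')`: of `e` and of a vector orthogonal to `e`.
  have hxv : ⟪(x' : Euc (d + 2)), v⟫ = 0 := by
    rw [hv, ← s.rot_lastVec x', LinearIsometryEquiv.inner_map_map, inner_lastVec_incl]
  have hxz' : ⟪(x' : Euc (d + 2)), (z' : Euc (d + 2))⟫ = 0 :=
    inner_equatorProj_of_orthogonal hv1 (by simp) h2'' hxv hxz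
  set l := rotor (midpointDir (z : Euc (d + 2)) z') z with hl
  have hbase : baseCoord (l * (k * g)) = x' := Subtype.ext (by
    change rot _ _ = _
    rw [rot_mul_apply, hkx]
    exact rot_rotor_midpointDir_of_orthogonal hzz' hxz hxz')
  refine ⟨l * (k * g), ?_, (spinEDist_rotor_mul_rotor_mul_le g ?_ ?_).trans
    (ENNReal.ofReal_le_ofReal ?_)⟩
  · change toSpheres s _ ∈ biEquator p q
    rw [toSpheres_mk]
    refine ⟨?_, ?_⟩
    · change ⟪(p : Euc (d + 2)), (baseCoord (l * (k * g)) : Euc (d + 2))⟫ = 0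
      rw [hbase]
      exact inner_equatorProj (by simp) (by simp) h1'
    · change ⟪(q : Euc (d + 1)), (fibreCoord s (l * (k * g)) : Euc (d + 1))⟫ = 0
      rw [inner_fibreCoord, hbase, ← hv, rot_mul_apply]
      have : rot l (z : Euc (d + 2)) = z' := rot_rotor_midpointDir hzz'
      exact (congrArg (fun u => ⟪v, u⟫) this).trans (inner_equatorProj hv1 (by simp) h2'')
  · exact (norm_midpointDir_sub_le hxx').trans (by linarith)
  · exact (norm_midpointDir_sub_le hzz').trans (by linarith)
  -- Each rotation has displacement at most `2 * δ`, and `16 * (2 * δ + 2 * δ) = 64 * δ`. The bound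
  -- `δ ≤ 1/4` puts both displacements within the `1/2` allowed for the arcs.
  · linarith [norm_midpointDir_sub_le hxx', norm_midpointDir_sub_le hzz']

end SpinBundle


open SpinBundle
/-- Here `n = k + 1` runs over the positive integers: the group is `Spin (2n+1)`, its subgroup is `Spin (2n-1)`, and
the base is `S^(2n) × S^(2n-1)`. -/
theorem mainTheorem3 (s : ∀ k : ℕ, SphereSection (2 * k + 1 + 1))
    (p : ∀ k : ℕ, Sph (2 * k + 1 + 1)) (q : ∀ k : ℕ, Sph (2 * k + 1)) :
    (∀ k, Function.Bijective (toSpheres (s k))) ∧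
    (∀ k (U : Set (Sph (2 * k + 1 + 1))), IsOpen U → ContinuousOn (s k).toFun U →
      ∃ Φ : OpenPartialHomeomorph (Spin (2 * k + 1 + 2) ⧸ spinSub (2 * k + 1))
          (Sph (2 * k + 1 + 1) × Sph (2 * k + 1)),
        Φ.source = {b | (toSpheres (s k) b).1 ∈ U} ∧ Φ.target = U ×ˢ Set.univ ∧
        Set.EqOn Φ (toSpheres (s k)) Φ.source) ∧
    (∀ k, Nonempty (biEquator (p k) (q k) ≃ᵢ Sph (2 * k + 1) × Sph (2 * k))) ∧
    (∀ ε : ℝ, 0 < ε → Tendsto (fun k => haarProb (2 * k + 1 + 2)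
      {g | toSpheres (s k) (g : Spin (2 * k + 1 + 2) ⧸ spinSub (2 * k + 1)) ∈
        Metric.thickening ε (biEquator (p k) (q k))}) atTop (𝓝 1)) ∧
    (∀ ε : ℝ, 0 < ε → Tendsto (fun k => haarProb (2 * k + 1 + 2)
      (tube ε (biEquatorLocus (s k) (p k) (q k)))) atTop (𝓝 1)) := by
  refine ⟨fun k => toSpheres_bijective (s k), fun k U hU hs =>
    ⟨toSpheresHomeomorph (s k) hU hs, rfl, rfl, fun _ _ => rfl⟩,
    fun k => nonempty_biEquator_isometryEquiv (p k) (q k), fun ε hε => ?_, fun ε hε => ?_⟩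
  · refine tendsto_haarProb_one (p := p)
      (w := fun k x => rot ((s k).toFun x) (incl (2 * k + 2) (q k : Euc (2 * k + 2))))
      (fun k => measurable_rot_section (s k) _) (fun k x => by simp)
      (δ := min (ε / 2) 1) (by positivity) fun k g h1 h2 => ?_
    refine thickening_mono (δ₁ := 2 * min (ε / 2) 1) ?_ _
      (mem_thickening_biEquator (min_le_right _ _) h1 ?_)
    · linarith [min_le_left (ε / 2) 1]
    · exact lt_of_eq_of_lt (congrArg abs (inner_fibreCoord (s k) (q k) g)) h2
  · refine tendsto_haarProb_one (p := p) (w := fun k => carriedPole (s k) (p k) (q k))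
      (fun k => measurable_carriedPole _ _ _) (fun k x => (norm_carriedPole _ _ _ x).le)
      -- The distance bound `64 * δ` is then at most `ε / 2`, strictly less than `ε`.
      (δ := min (ε / 128) (1 / 4)) (by positivity) fun k g h1 h2 => ?_
    obtain ⟨a, ha, hga⟩ := exists_mem_biEquatorLocus_spinEDist_le (s k) (p k) (q k) g
      (min_le_right _ _) h1 h2
    refine ⟨a, ha, hga.trans_lt ((ENNReal.ofReal_lt_ofReal_iff hε).2 ?_)⟩
    linarith [min_le_left (ε / 128) (1 / 4)]
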